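/- **Model.** There are $L\ge 1$ drivers. A state $(l,m)$, $0\le l\le L$, $m\ge 0$, has $l$ drivers in service and $m$ riders in the queue. A policy $(\lambda,\phi)$ consists of request rates $\lambda(l,m)\in[0,\Lambda]$, $\Lambda>0$, and a dispatching rule $\phi(l,m)\in\{0,1\}$ with $\phi(l,0)=\phi(L,m)=0$. Riders join at rate $\lambda(l,m)$, giving $(l,m+1)$; trips are completed at rate $l\mu_{l,m}$, giving $(l-1,m)$; after each event, as long as $\phi=1$ in the current state $(l,m)$, the state moves instantaneously to $(l+1,m-1)$. Here $0<\mu_{l,m}\le\bar\mu$. The price per kilometre $p_1(\lambda)\in[0,p_{\max}]$ is determined by $\lambda=\Lambda(1-F(p_1))$, where $F$ is a strictly increasing bijection from $[0,p_{\max}]$ onto $[0,1]$. The objective is $$\sum_{(l,m)}\pi(l,m)\Big(\lambda(l,m)\big(p_0+w_p^rt_0+p_1(\lambda(l,m))\,t_0\big)-c_d\,l-c_r\,m\Big),$$ with $\pi$ a stationary distribution of the policy, $p_0\ge 0$, $t_0>0$, positive weights $w_s^d,w_o^d,w_p^r,w_q^r$, $c_d=w_s^d+w_p^r-w_o^d$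 and $c_r=w_q^r$; it is $-\infty$ if there is no stationary distribution or the mean queue length is infinite. A policy is optimal if it has a unique stationary distribution and the resulting objective is at least that of every policy in every stationary distribution of it. A state $(l,m)$ is of *type 1* if $l=L$ or $m=0$ or $l\mu_{l,m}>(l+1)\mu_{l+1,m-1}$, and of *type 2* otherwise. Let $\phi^*$ be the rule that is $0$ on type-1 states and $1$ on type-2 states. Its zigzag path starts at $(0,0)$ and moves from $(l,m)$ to $(l+1,m)$ if $\phi^*(l,m+1)=1$ and to $(l,m+1)$ otherwise. **Algorithm** (queue bound $M\ge 0$). For a path $P=(s_1,\dots,s_I)$ and request rates $\lambda$, with new riders rejected in $s_I$ (that is, $\lambda(s_I)$ is replaced by $0$), let $\tilde{\mathcal R}(\lambda,P)$ be the objective of the birth–death chain on $P$, whose stationary distribution is $\pi(s_i)\propto\prod_{j=1}^{i-1}\lambda(s_j)/r(s_{j+1})$ with $r(l,m)=l\mu_{l,m}$. Let $V(P)=\sup_{\bar\lambda\in[0,\Lambda]}\tilde{\mathcal R}(\bar\lambda,P)$ over constant rates. Put $P_{0,m}=((0,m))$, $R_{0,m}=0$, $P_{l,0}=((0,0),\dots,(l,0))$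 and $R_{l,0}=\max\{R_{l-1,0},V(P_{l,0})\}$. For $m=1,\dots,M$ and $l=1,\dots,L$ append $(l,m)$ to $P_{l-1,m}$ and to $P_{l,m-1}$, giving $P_{\rm above}$ and $P_{\rm left}$; let $\mathcal R_{\rm above}=\max\{R_{l-1,m},V(P_{\rm above})\}$ and $\mathcal R_{\rm left}=\max\{R_{l,m-1},V(P_{\rm left})\}$; let $(P_{l,m},R_{l,m})$ be the path with the larger value together with that value, where on a tie $P_{l,m}=P_{\rm above}$ if $(l-1,m)$ is of type 1 and $P_{l,m}=P_{\rm left}$ otherwise. The output is the path $P_{L,M}$, the dispatching rule that is $1$ exactly at the states $(l,m)$ with $l<L$ that lie to the right of all states of $P_{L,M}$ in row $l$, and a request-rate function $\lambda^*$ that maximizes $\tilde{\mathcal R}(\cdot,P_{L,M})$, with riders rejected in the last state and off the path. **Theorem.** Assume $c_d=c_r$ and that, on $0\le l\le L$, $m\ge0$, 1. $l\mu_{l,m+1}-l\mu_{l,m}$ is non-increasing in $m$ and non-decreasing in $l$; 2. $(l+1)\mu_{l+1,m}-l\mu_{l,m}$ (for $l<L$) is non-increasing in $l$ and non-decreasing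 in $m$. Then for every $M\ge 0$: - $P_{L,M}$ begins with the part of the zigzag path of $\phi^*$ that lies in $\{m\le M\}$. - The returned dispatching rule is $0$ on all type-1 states and $1$ on all type-2 states with $m\le M$. - A maximizer $\lambda^*$ exists, and for each one the returned policy is optimal when only stationary distributions supported on $\{m\le M\}$ are allowed. - If moreover $c_rM\ge L\bar\mu\,(p_0+w_p^rt_0+p_{\max}t_0)$, then the returned policy is optimal among all policies, without any bound on the queue, and so is the policy that uses $\lambda^*$ together with $\phi^*$ on the whole state space. -/

import Mathlib

open Set

noncomputable section

namespace SpatialQueue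

/-- A state `(l, m)`: `l` drivers in service, `m` riders waiting in the queue. The actual states of
a model with `L` drivers are those with `l ≤ L`. -/
abbrev State := ℕ × ℕ

/-- The data of the ride-hailing platform. -/
structure Model where
  /-- total number of drivers -/
  L : ℕ
  one_le_L : 1 ≤ L
  /-- rate of arrival of riders, before pricing -/
  Lam : ℝ
  Lam_pos : 0 < Lam
  /-- service rate of each busy driver in each state, and an upper bound for it -/
  mu : State → ℝ
  muBar : ℝ
  mu_pos : ∀ l ≤ L, ∀ m, 0 < mu (l, m)
  mu_le : ∀ l ≤ L, ∀ m, mu (l, m) ≤ muBar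
  /-- base fare -/
  p0 : ℝ
  p0_nonneg : 0 ≤ p0
  /-- mean on-trip time -/
  t0 : ℝ
  t0_pos : 0 < t0
  /-- largest per-kilometre price -/
  pMax : ℝ
  pMax_pos : 0 < pMax
  /-- distribution function of the willingness to pay per kilometre, on `[0, pMax]` -/
  F : ℝ → ℝ
  F_zero : F 0 = 0
  F_pMax : F pMax = 1
  F_strictMono : StrictMonoOn F (Icc 0 pMax)
  F_surj : SurjOn F (Icc 0 pMax) (Icc 0 1)
  /-- unit costs: driver in service, idle driver, rider waiting for pick-up, rider in the queue -/
  wSD : ℝ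
  wOD : ℝ
  wPR : ℝ
  wQR : ℝ
  wSD_pos : 0 < wSD
  wOD_pos : 0 < wOD
  wPR_pos : 0 < wPR
  wQR_pos : 0 < wQR

namespace Model

variable (D : Model)

/-- Driver-side penalty coefficient. -/
def cd : ℝ := D.wSD + D.wPR - D.wOD

/-- Rider-side penalty coefficient. -/
def cr : ℝ := D.wQR

/-- Total service (trip completion) rate `l μ_{l,m}`. -/
def serviceRate (s : State) : ℝ := (s.1 : ℝ) * D.mu s

/-- The per-kilometre price `p₁(x)` at which the effective request rate `Λ (1 - F p₁)` is `x`. -/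
def unitPrice (x : ℝ) : ℝ := Function.invFunOn (fun p => D.Lam * (1 - D.F p)) (Icc 0 D.pMax) x

/-- Payoff per accepted rider at effective request rate `x`. -/
def fare (x : ℝ) : ℝ := D.p0 + D.wPR * D.t0 + D.unitPrice x * D.t0

/-- The largest possible payoff per rider. -/
def fareMax : ℝ := D.p0 + D.wPR * D.t0 + D.pMax * D.t0

/-- Reward rate in state `s` at effective request rate `x`. -/
def reward (x : ℝ) (s : State) : ℝ := x * D.fare x - D.cd * s.1 - D.cr * s.2

/-- The diminishing-returns conditions on the total service rates. -/
structure DiminishingReturns : Prop where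
  incr_m_anti_m : ∀ l ≤ D.L,
    Antitone fun m : ℕ => D.serviceRate (l, m + 1) - D.serviceRate (l, m)
  incr_m_mono_l : ∀ m : ℕ,
    MonotoneOn (fun l : ℕ => D.serviceRate (l, m + 1) - D.serviceRate (l, m)) (Iic D.L)
  incr_l_anti_l : ∀ m : ℕ,
    AntitoneOn (fun l : ℕ => D.serviceRate (l + 1, m) - D.serviceRate (l, m)) (Iio D.L)
  incr_l_mono_m : ∀ l < D.L,
    Monotone fun m : ℕ => D.serviceRate (l + 1, m) - D.serviceRate (l, m)

/-- Type 1 states (for `l ≤ L`). -/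
def Type1 (s : State) : Prop :=
  s.1 = D.L ∨ s.2 = 0 ∨ D.serviceRate (s.1 + 1, s.2 - 1) < D.serviceRate s

/-- Type 2 states. -/
def Type2 (s : State) : Prop :=
  s.1 < D.L ∧ s.2 ≠ 0 ∧ D.serviceRate s ≤ D.serviceRate (s.1 + 1, s.2 - 1)

end Model

/-! ### Policies, the controlled Markov chain, and optimality -/

/-- A policy: in each state, whether to dispatch (`true`) or hold (`false`), and the effective
request rate (equivalently, the price). -/
structure Policy where
  dispatch : State → Bool
  rate : State → ℝ

/-- The state in which the system comes to rest when, from `(l, m)`, drivers are dispatched one by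
one, instantaneously, until the dispatching rule says hold. -/
def settle (φ : State → Bool) : ℕ → ℕ → State
  | l, 0 => (l, 0)
  | l, m + 1 => if φ (l, m + 1) then settle φ (l + 1) m else (l, m + 1)

namespace Model

variable (D : Model)

/-- Rates lie in `[0, Λ]`, and there is no dispatch without a queueing rider and an idle driver. -/
structure Admissible (q : Policy) : Prop where
  rate_mem : ∀ l ≤ D.L, ∀ m, q.rate (l, m) ∈ Icc 0 D.Lam
  hold_no_rider : ∀ l ≤ D.L, q.dispatch (l, 0) = false
  hold_no_driver : ∀ m, q.dispatch (D.L, m) = false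

open Classical in
/-- Transition rate from `s` to `t`: a rider joins, or a trip is completed (rate `0` if no driver
is in service), in either case followed by the dispatches that the policy prescribes. -/
def transRate (q : Policy) (s t : State) : ℝ :=
  (if settle q.dispatch s.1 (s.2 + 1) = t then q.rate s else 0) +
  (if settle q.dispatch (s.1 - 1) s.2 = t then D.serviceRate s else 0)

/-- `π` is a stationary distribution of the chain under `q`. It gives no mass to states that the
policy leaves at once by a dispatch. All total jump rates are bounded, so that stationarity is the
global balance equation. A transition changes `l + m` by one, so a state has no jump to itself and
the sum on the right has finitely many nonzero terms. -/
structure IsStationary (q : Policy) (π : State → ℝ) : Prop where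
  nonneg : ∀ s, 0 ≤ π s
  hasSum_one : HasSum π 1
  support_states : ∀ s, D.L < s.1 → π s = 0
  support_hold : ∀ s, q.dispatch s = true → π s = 0
  balance : ∀ t, π t * (q.rate t + D.serviceRate t) = ∑' s, π s * D.transRate q s t

/-- `v` is the long-run average objective (revenue rate minus penalty rates) in the stationary
regime `π`. Reward rates are bounded above, so when `c_r > 0` the sum fails to converge only if it
is `-∞`, that is, if the mean queue length is infinite. -/
def HasObjective (q : Policy) (π : State → ℝ) (v : ℝ) : Prop :=
  HasSum (fun s => π s * D.reward (q.rate s) s) v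

/-- `q` is optimal for the objective among all policies, where only stationary regimes with
property `A` count. The policy `q` has exactly one stationary regime; the competitors may have
several, and each of them is beaten. Policies without a stationary regime, or with infinite mean
queue length, have objective `-∞`. -/
def IsOptimalAmong (A : (State → ℝ) → Prop) (q : Policy) : Prop :=
  D.Admissible q ∧ ∃ π v, D.IsStationary q π ∧ (∀ π', D.IsStationary q π' → π' = π) ∧ A π ∧
    D.HasObjective q π v ∧
    ∀ q' π' v', D.Admissible q' → D.IsStationary q' π' → A π' → D.HasObjective q' π' v' → v' ≤ v

/-- Optimality among all policies. -/
def IsOptimal (q : Policy) : Prop := D.IsOptimalAmong (fun _ => True) q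

/-- Optimality when the queue may never hold more than `M` riders. -/
def IsOptimalQueueBounded (M : ℕ) (q : Policy) : Prop :=
  D.IsOptimalAmong (fun π => ∀ s : State, M < s.2 → π s = 0) q

/-! ### Zigzag paths -/

open Classical in
/-- The dispatching rule that holds on type 1 states and dispatches on type 2 states. -/
def typeRule (s : State) : Bool := decide (D.Type2 s)

/-- The (infinite) zigzag path from `(0, 0)` of a dispatching rule: a step down, to `(l + 1, m)`, if
the rule dispatches at `(l, m + 1)`, and a step to the right, to `(l, m + 1)`, otherwise. -/
def zigzag (φ : State → Bool) : ℕ → State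
  | 0 => (0, 0)
  | k + 1 =>
    let s := zigzag φ k
    if φ (s.1, s.2 + 1) then (s.1 + 1, s.2) else (s.1, s.2 + 1)

open Classical in
/-- The dispatching policy of a finite path: dispatch exactly in the states to the right of it (and
never when all drivers are busy). -/
def pathDispatch (P : List State) (s : State) : Bool :=
  decide (s.1 < D.L ∧ (∃ m, (s.1, m) ∈ P) ∧ ∀ m, (s.1, m) ∈ P → m < s.2)

/-- Request rates along a path: `x` before the last state; new riders are rejected in the last
state (and off the path). -/
def pathRate (P : List State) (x : State → ℝ) (s : State) : ℝ :=
  if s ∈ P.dropLast then x s else 0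

/-- The `i`-th state of a path, counted from `0`. -/
def nth (P : List State) (i : ℕ) : State := P.getD i (0, 0)

/-- Unnormalised stationary weight of the `i`-th state of a path (a birth-death chain). -/
def pathWeight (P : List State) (x : State → ℝ) (i : ℕ) : ℝ :=
  ∏ j ∈ Finset.range i, pathRate P x (nth P j) / D.serviceRate (nth P (j + 1))

/-- The objective of the path `P` with request rates `x`, through its closed-form stationary
distribution. -/
def pathValue (P : List State) (x : State → ℝ) : ℝ :=
  ∑ i ∈ Finset.range P.length,
    D.pathWeight P x i / (∑ k ∈ Finset.range P.length, D.pathWeight P x k) *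
      D.reward (pathRate P x (nth P i)) (nth P i)

/-- The best objective of a path under static pricing. -/
def staticValue (P : List State) : ℝ :=
  sSup ((fun r : ℝ => D.pathValue P (fun _ => r)) '' Icc 0 D.Lam)

/-- `x` is an optimal dynamic pricing along the path `P`. -/
def IsOptimalPricing (P : List State) (x : State → ℝ) : Prop :=
  (∀ s, x s ∈ Icc 0 D.Lam) ∧
    ∀ y : State → ℝ, (∀ s, y s ∈ Icc 0 D.Lam) → D.pathValue P y ≤ D.pathValue P x

/-- The policy given by a path and request rates along it. -/
def pathPolicy (P : List State) (x : State → ℝ) : Policy where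
  dispatch := D.pathDispatch P
  rate := pathRate P x

/-! ### The dynamic-programming heuristic -/

/-- An entry of the table: the retained path ending there, and the recorded objective. -/
structure Cell where
  path : List State
  value : ℝ

open Classical in
/-- The entry at `(l + 1, m)`, from the entries `above` at `(l, m)` and `left` at
`(l + 1, m - 1)`. -/
def update (above left : Cell) (l m : ℕ) : Cell :=
  let Pabove := above.path ++ [(l + 1, m)]
  let Pleft := left.path ++ [(l + 1, m)]
  let Rabove := max above.value (D.staticValue Pabove)
  let Rleft := max left.value (D.staticValue Pleft)
  if Rabove < Rleft then ⟨Pleft, Rleft⟩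
  else if Rleft < Rabove then ⟨Pabove, Rabove⟩
  else ⟨if D.Type1 (l, m) then Pabove else Pleft, Rleft⟩

/-- The column `m = 0` of the table, as a function of `l`. -/
def firstColumn : ℕ → Cell
  | 0 => ⟨[(0, 0)], 0⟩
  | l + 1 =>
    let P : List State := (firstColumn l).path ++ [(l + 1, 0)]
    ⟨P, max (firstColumn l).value (D.staticValue P)⟩

/-- The column `m ≥ 1` of the table, from the column before it. -/
def nextColumn (m : ℕ) (prev : ℕ → Cell) : ℕ → Cell
  | 0 => ⟨[(0, m)], 0⟩
  | l + 1 => D.update (nextColumn m prev l) (prev (l + 1)) l m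

/-- The table, column by column: `table m l` is the entry at `(l, m)`. -/
def table : ℕ → ℕ → Cell
  | 0 => D.firstColumn
  | m + 1 => D.nextColumn (m + 1) (table m)

/-- The path returned by the heuristic with queue bound `M`: the one retained at `(L, M)`. -/
def outputPath (M : ℕ) : List State := (D.table M D.L).path

end Model

end SpatialQueue

end

/-!
Since `c_d = c_r`, the reward depends on the state only through the request rate and the level
`l + m`, and by cut balance between consecutive levels a policy is worth what a birth-death chain on
the levels is worth. Larger service rates can only help such a chain. Diminishing returns make the
service rate unimodal along each level, with its maximum on the zigzag path of `φ*`, so that inside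
a box of the table the zigzag path clipped to the box is best at every level. Hence the dynamic
program keeps exactly the clipped path; its tie-breaking rule matters because the recorded values
cannot distinguish paths that differ only beyond the best place to reject riders.

Backward recursion over the levels produces shadow prices `δ` that satisfy the Bellman inequality
with the value of the path, and averaging this inequality over any stationary regime bounds the
objective of any policy. When `c_r M ≥ L μ̄ (p₀ + w t₀ + p_max t₀)`, setting `δ` to the largest fare
from level `M` on keeps the inequality valid without a bound on the queue. Every accepted rider pays
less than that, so by complementary slackness an optimal pricing rejects riders in some state before
level `M`, and what the dispatching rule does beyond the table never matters.
-/

noncomputable section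

namespace SpatialQueue

/-! ### Birth-death chains -/

lemma sum_mul_mul_sum_sub {ι : Type*} (s : Finset ι) (w w' f : ι → ℝ) :
    2 * ((∑ i ∈ s, w' i * f i) * ∑ k ∈ s, w k - (∑ i ∈ s, w i * f i) * ∑ k ∈ s, w' k) =
      ∑ i ∈ s, ∑ k ∈ s, (w' i * w k - w i * w' k) * (f i - f k) := by
  have expand (u v : ι → ℝ) : (∑ i ∈ s, u i) * ∑ k ∈ s, v k = ∑ i ∈ s, ∑ k ∈ s, u i * v k :=
    Finset.sum_mul_sum ..
  have swap (u v : ι → ℝ) : (∑ i ∈ s, u i) * ∑ k ∈ s, v k = ∑ i ∈ s, ∑ k ∈ s, v i * u k := by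
    rw [mul_comm, expand]
  rw [two_mul]
  nth_rewrite 1 [expand, expand]
  rw [swap, swap]
  simp only [← Finset.sum_add_distrib, ← Finset.sum_sub_distrib]
  exact Finset.sum_congr rfl fun i _ => Finset.sum_congr rfl fun k _ => by ring

/-- The hypothesis `hlr` is the likelihood-ratio order on weights. -/
lemma centerMass_le_centerMass {ι : Type*} [LinearOrder ι] {s : Finset ι} {w w' f : ι → ℝ}
    (hw : 0 < ∑ i ∈ s, w i) (hw' : 0 < ∑ i ∈ s, w' i)
    (hlr : ∀ i ∈ s, ∀ k ∈ s, i < k → w i * w' k ≤ w' i * w k) (hf : AntitoneOn f s) :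
    s.centerMass w f ≤ s.centerMass w' f := by
  have hsum : 0 ≤ ∑ i ∈ s, ∑ k ∈ s, (w' i * w k - w i * w' k) * (f i - f k) := by
    refine Finset.sum_nonneg fun i hi => Finset.sum_nonneg fun k hk => ?_
    rcases lt_trichotomy i k with hik | rfl | hki
    · exact mul_nonneg (sub_nonneg.2 (hlr i hi k hk hik)) (sub_nonneg.2 (hf hi hk hik.le))
    · simp
    · refine mul_nonneg_of_nonpos_of_nonpos ?_ (sub_nonpos.2 (hf hk hi hki.le))
      linarith [hlr k hk i hi hki]
  rw [← sum_mul_mul_sum_sub] at hsum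
  simp only [Finset.centerMass, smul_eq_mul, ← div_eq_inv_mul]
  rw [div_le_div_iff₀ hw hw']
  linarith

lemma centerMass_Ico_le_centerMass_range {w f : ℕ → ℝ} {k n : ℕ} (hk : k < n)
    (hw : ∀ i < n, 0 < w i) (hf : Antitone f) :
    (Finset.Ico k n).centerMass w f ≤ (Finset.range n).centerMass w f := by
  set v : ℕ → ℝ := fun i => if k ≤ i then w i else 0 with hv
  have hsub : Finset.Ico k n ⊆ Finset.range n := fun i hi =>
    Finset.mem_range.2 (Finset.mem_Ico.1 hi).2
  have hzero : ∀ i ∈ Finset.range n, i ∉ Finset.Ico k n → v i = 0 := fun i hi hik =>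
    if_neg fun h => hik (Finset.mem_Ico.2 ⟨h, Finset.mem_range.1 hi⟩)
  have hvw : ∀ i ∈ Finset.Ico k n, w i = v i := fun i hi => (if_pos (Finset.mem_Ico.1 hi).1).symm
  rw [Finset.centerMass_congr_weights hvw, Finset.centerMass_subset _ hsub hzero]
  refine centerMass_le_centerMass ?_ ?_ (fun i hi j hj hij => ?_) (hf.antitoneOn _)
  · rw [← Finset.sum_subset hsub hzero, ← Finset.sum_congr rfl hvw]
    exact Finset.sum_pos (fun i hi => hw i (Finset.mem_Ico.1 hi).2)
      ⟨k, Finset.mem_Ico.2 ⟨le_rfl, hk⟩⟩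
  · exact Finset.sum_pos (fun i hi => hw i (Finset.mem_range.1 hi)) ⟨k, Finset.mem_range.2 hk⟩
  · have := mul_pos (hw i (Finset.mem_range.1 hi)) (hw j (Finset.mem_range.1 hj))
    simp only [hv]
    split_ifs <;> first | omega | linarith

/-- Unnormalised stationary weights of the birth-death chain with birth rates `x` and death
rates `ρ`. -/
def chainWeight (ρ x : ℕ → ℝ) (i : ℕ) : ℝ := ∏ j ∈ Finset.range i, x j / ρ (j + 1)

section ChainWeight

variable {ρ ρ' x x' : ℕ → ℝ} {n i j k : ℕ}

lemma chainWeight_zero (ρ x : ℕ → ℝ) : chainWeight ρ x 0 = 1 := Finset.prod_range_zero _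

lemma chainWeight_succ (h : ρ (i + 1) ≠ 0) :
    chainWeight ρ x (i + 1) * ρ (i + 1) = chainWeight ρ x i * x i := by
  rw [chainWeight, Finset.prod_range_succ, ← chainWeight, mul_assoc, div_mul_cancel₀ _ h]

lemma chainWeight_add (ρ x : ℕ → ℝ) (k i : ℕ) : chainWeight ρ x (k + i) =
    chainWeight ρ x k * chainWeight (fun j => ρ (k + j)) (fun j => x (k + j)) i :=
  Finset.prod_range_add ..

lemma chainWeight_nonneg (hρ : ∀ j < i, 0 < ρ (j + 1)) (hx : ∀ j < i, 0 ≤ x j) :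
    0 ≤ chainWeight ρ x i :=
  Finset.prod_nonneg fun j hj =>
    div_nonneg (hx j (Finset.mem_range.1 hj)) (hρ j (Finset.mem_range.1 hj)).le

lemma chainWeight_pos (hρ : ∀ j < i, 0 < ρ (j + 1)) (hx : ∀ j < i, 0 < x j) :
    0 < chainWeight ρ x i :=
  Finset.prod_pos fun j hj =>
    div_pos (hx j (Finset.mem_range.1 hj)) (hρ j (Finset.mem_range.1 hj))

lemma chainWeight_eq_zero (hj : x j = 0) (h : j < i) : chainWeight ρ x i = 0 :=
  Finset.prod_eq_zero (Finset.mem_range.2 h) (by rw [hj, zero_div])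

lemma chainWeight_congr (hρ : ∀ j < i, ρ (j + 1) = ρ' (j + 1)) (hx : ∀ j < i, x j = x' j) :
    chainWeight ρ x i = chainWeight ρ' x' i :=
  Finset.prod_congr rfl fun j hj => by
    rw [hx j (Finset.mem_range.1 hj), hρ j (Finset.mem_range.1 hj)]

lemma chainWeight_anti (hρ : ∀ j < i, 0 < ρ (j + 1)) (hle : ∀ j < i, ρ (j + 1) ≤ ρ' (j + 1))
    (hx : ∀ j < i, 0 ≤ x j) : chainWeight ρ' x i ≤ chainWeight ρ x i := by
  refine Finset.prod_le_prod (fun j hj => ?_) fun j hj => ?_ <;> rw [Finset.mem_range] at hj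
  · exact div_nonneg (hx j hj) ((hρ j hj).trans_le (hle j hj)).le
  · exact div_le_div_of_nonneg_left (hx j hj) (hρ j hj) (hle j hj)

lemma sum_chainWeight_pos (hρ : ∀ i < n, 0 < ρ (i + 1)) (hx : ∀ i < n, 0 ≤ x i) :
    0 < ∑ i ∈ Finset.range (n + 1), chainWeight ρ x i := by
  refine Finset.sum_pos' (fun i hi => ?_) ⟨0, by simp, by simp [chainWeight_zero]⟩
  rw [Finset.mem_range] at hi
  exact chainWeight_nonneg (fun j hj => hρ j (by omega)) fun j hj => hx j (by omega)

lemma eq_chainWeight_div_sum {a : ℕ → ℝ} (hρ : ∀ i < n, 0 < ρ (i + 1))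
    (ha : ∀ i < n, a (i + 1) * ρ (i + 1) = a i * x i)
    (hone : ∑ i ∈ Finset.range (n + 1), a i = 1) (hi : i ≤ n) :
    a i = chainWeight ρ x i / ∑ j ∈ Finset.range (n + 1), chainWeight ρ x j := by
  have hmul : ∀ j ≤ n, a j = a 0 * chainWeight ρ x j := by
    intro j
    induction j with
    | zero => simp [chainWeight_zero]
    | succ j ih =>
      intro hj
      refine mul_right_cancel₀ (hρ j hj).ne' ?_
      rw [ha j hj, mul_assoc, chainWeight_succ (hρ j hj).ne', ih (Nat.le_of_succ_le hj), mul_assoc]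
  rw [Finset.sum_congr rfl fun j hj => hmul j (Nat.lt_succ_iff.1 (Finset.mem_range.1 hj)),
    ← Finset.mul_sum] at hone
  rw [hmul i hi, eq_one_div_of_mul_eq_one_left hone]
  ring

/-- The cut equations of the chain, summed by parts against `δ`. -/
lemma sum_chainWeight_mul_flow (hρ₀ : ρ 0 = 0) (hρ : ∀ i < n, 0 < ρ (i + 1)) (δ : ℕ → ℝ) :
    ∑ i ∈ Finset.range (n + 1), chainWeight ρ x i * (x i * δ (i + 1) - ρ i * δ i) =
      chainWeight ρ x n * (x n * δ (n + 1)) := by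
  induction n with
  | zero => simp [hρ₀]
  | succ n ih =>
    rw [Finset.sum_range_succ, ih fun i hi => hρ i (by omega)]
    linear_combination -δ (n + 1) * chainWeight_succ (x := x) (hρ n (by omega)).ne'

end ChainWeight

/-- Long-run average reward of the birth-death chain on `{0, …, n}` that earns `g (x i)` and pays
`c * i` in state `i`. The last state rejects arrivals, so it is meant for birth rates with
`x n = 0`. -/
def chainValue (g : ℝ → ℝ) (c : ℝ) (ρ x : ℕ → ℝ) (n : ℕ) : ℝ :=
  (Finset.range (n + 1)).centerMass (chainWeight ρ x) fun i => g (x i) - c * i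

/-- The birth rates of static pricing on `{0, …, n}`: the rate `a` below `n`, rejection at `n`. -/
def staticRate (a : ℝ) (n i : ℕ) : ℝ := if i < n then a else 0

lemma staticRate_of_lt {a : ℝ} {n i : ℕ} (h : i < n) : staticRate a n i = a := if_pos h

lemma staticRate_mem {a b : ℝ} (ha : a ∈ Icc 0 b) (n i : ℕ) : staticRate a n i ∈ Icc 0 b := by
  unfold staticRate
  split_ifs
  · exact ha
  · exact ⟨le_rfl, ha.1.trans ha.2⟩

section ChainValue

variable {g : ℝ → ℝ} {c : ℝ} {ρ ρ' x x' : ℕ → ℝ} {n j k : ℕ}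

lemma chainValue_congr (hρ : ∀ i < n, ρ (i + 1) = ρ' (i + 1)) (hx : ∀ i ≤ n, x i = x' i) :
    chainValue g c ρ x n = chainValue g c ρ' x' n := by
  have hw : ∀ i ∈ Finset.range (n + 1), chainWeight ρ x i = chainWeight ρ' x' i := fun i hi => by
    rw [Finset.mem_range] at hi
    exact chainWeight_congr (fun j hj => hρ j (by omega)) fun j hj => hx j (by omega)
  rw [chainValue, chainValue, Finset.centerMass, Finset.centerMass, Finset.sum_congr rfl hw]
  congr 1
  exact Finset.sum_congr rfl fun i hi => by
    rw [hw i hi, hx i (Nat.lt_succ_iff.1 (Finset.mem_range.1 hi))]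

/-- A chain that rejects in state `j` lives on `{0, …, j}`. -/
lemma chainValue_eq_of_eq_zero (hj : j ≤ n) (h : x j = 0) :
    chainValue g c ρ x n = chainValue g c ρ x j := by
  refine (Finset.centerMass_subset _ (Finset.range_subset_range.2 (by omega)) ?_).symm
  intro i _ hi
  exact chainWeight_eq_zero h (by rw [Finset.mem_range] at hi; omega)

lemma chainValue_eq_zero (h₀ : g 0 = 0) (hx : x 0 = 0) : chainValue g c ρ x n = 0 := by
  rw [chainValue_eq_of_eq_zero (Nat.zero_le n) hx]
  simp [chainValue, Finset.centerMass, hx, h₀]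

lemma chainValue_le {B : ℝ} (hc : 0 ≤ c) (hρ : ∀ i < n, 0 < ρ (i + 1)) (hx : ∀ i < n, 0 ≤ x i)
    (hB : ∀ i ≤ n, g (x i) ≤ B) : chainValue g c ρ x n ≤ B := by
  refine (convex_Iic B).centerMass_mem (fun i hi => ?_) (sum_chainWeight_pos hρ hx)
    fun i hi => ?_ <;> rw [Finset.mem_range] at hi
  · exact chainWeight_nonneg (fun j hj => hρ j (by omega)) fun j hj => hx j (by omega)
  · have : 0 ≤ c * i := by positivity
    exact (sub_le_self _ this).trans (hB i (by omega))

lemma continuousOn_chainValue {t : Set ℝ} (hρ : ∀ i < n, 0 < ρ (i + 1)) (ht : ∀ a ∈ t, 0 ≤ a)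
    (hg : ContinuousOn g t) :
    ContinuousOn (fun x => chainValue g c ρ x n) (univ.pi fun _ => t) := by
  have hw (i : ℕ) : Continuous fun x => chainWeight ρ x i :=
    continuous_finsetProd _ fun j _ => (continuous_apply j).div_const _
  have hg' (i : ℕ) : ContinuousOn (fun x : ℕ → ℝ => g (x i) - c * i) (univ.pi fun _ => t) :=
    (hg.comp (continuous_apply i).continuousOn fun x (hx : x ∈ univ.pi _) => hx i trivial).sub
      continuousOn_const
  have hsum : Continuous fun x => ∑ i ∈ Finset.range (n + 1), chainWeight ρ x i :=
    continuous_finsetSum _ fun i _ => hw i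
  have hne (x : ℕ → ℝ) (hx : x ∈ univ.pi fun _ : ℕ => t) :
      ∑ i ∈ Finset.range (n + 1), chainWeight ρ x i ≠ 0 :=
    (sum_chainWeight_pos hρ fun i _ => ht _ (hx i trivial)).ne'
  simp only [chainValue, Finset.centerMass]
  exact (hsum.continuousOn.inv₀ hne).smul
    (continuousOn_finsetSum _ fun i _ => (hw i).continuousOn.smul (hg' i))

lemma sum_chainWeight_mul_slack (hρ₀ : ρ 0 = 0) (hρ : ∀ i < n, 0 < ρ (i + 1))
    (hx : ∀ i < n, 0 ≤ x i) (hxn : x n = 0) (V : ℝ) (δ : ℕ → ℝ) :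
    ∑ i ∈ Finset.range (n + 1), chainWeight ρ x i *
        (V + c * i - (g (x i) - x i * δ (i + 1) + ρ i * δ i)) =
      (V - chainValue g c ρ x n) * ∑ i ∈ Finset.range (n + 1), chainWeight ρ x i := by
  have hW := (sum_chainWeight_pos hρ hx).ne'
  have hflow := sum_chainWeight_mul_flow (x := x) hρ₀ hρ δ
  rw [hxn, zero_mul, mul_zero] at hflow
  have hvalue : chainValue g c ρ x n * ∑ i ∈ Finset.range (n + 1), chainWeight ρ x i =
      ∑ i ∈ Finset.range (n + 1), chainWeight ρ x i * (g (x i) - c * i) := by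
    simp only [chainValue, Finset.centerMass, smul_eq_mul]
    field_simp
  rw [sub_mul, hvalue, Finset.mul_sum, ← Finset.sum_sub_distrib, ← sub_zero (∑ _ ∈ _, _), ← hflow,
    ← sub_eq_zero, ← Finset.sum_sub_distrib, ← Finset.sum_sub_distrib]
  exact Finset.sum_eq_zero fun i _ => by ring

lemma antitone_static_reward {a : ℝ} (h₀ : g 0 = 0) (hc : 0 ≤ c) (ha : 0 ≤ g a) (n : ℕ) :
    Antitone fun i : ℕ => g (staticRate a n i) - c * i := by
  intro i k hik
  have hcost : c * i ≤ c * k := mul_le_mul_of_nonneg_left (Nat.cast_le.2 hik) hc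
  have hrevenue : g (staticRate a n k) ≤ g (staticRate a n i) := by
    unfold staticRate
    split_ifs <;> first | omega | simp [h₀, ha]
  simp only
  linarith

lemma chainValue_static_mono {a : ℝ} (h₀ : g 0 = 0) (hc : 0 ≤ c) (ha : 0 ≤ a) (hga : 0 ≤ g a)
    (hρ : ∀ i < n, 0 < ρ (i + 1)) (hle : ∀ i < n, ρ (i + 1) ≤ ρ' (i + 1)) :
    chainValue g c ρ (staticRate a n) n ≤ chainValue g c ρ' (staticRate a n) n := by
  have hρ' (i) (hi : i < n) : 0 < ρ' (i + 1) := (hρ i hi).trans_le (hle i hi)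
  have hx (i : ℕ) : 0 ≤ staticRate a n i := (staticRate_mem ⟨ha, le_rfl⟩ n i).1
  refine centerMass_le_centerMass (sum_chainWeight_pos hρ fun i _ => hx i)
    (sum_chainWeight_pos hρ' fun i _ => hx i) (fun i _ k hk hik => ?_)
    ((antitone_static_reward h₀ hc hga n).antitoneOn _)
  obtain ⟨d, rfl⟩ := Nat.exists_eq_add_of_lt hik
  rw [Finset.mem_range] at hk
  rw [add_assoc, chainWeight_add, chainWeight_add ρ, mul_left_comm]
  refine mul_le_mul_of_nonneg_left (mul_le_mul_of_nonneg_left ?_ ?_) ?_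
  · exact chainWeight_anti (fun j hj => hρ (i + j) (by omega)) (fun j hj => hle (i + j) (by omega))
      fun j _ => hx _
  · exact chainWeight_nonneg (fun j hj => hρ j (by omega)) fun j _ => hx j
  · exact chainWeight_nonneg (fun j hj => hρ' j (by omega)) fun j _ => hx j

lemma chainValue_shift (hρ : ∀ i < n, 0 < ρ (k + i + 1)) (hx : ∀ i < n, 0 ≤ x (k + i))
    (hk : chainWeight ρ x k ≠ 0) :
    chainValue g c (fun i => ρ (k + i)) (fun i => x (k + i)) n - c * k =
      (Finset.Ico k (k + n + 1)).centerMass (chainWeight ρ x) fun i => g (x i) - c * i := by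
  have hW := sum_chainWeight_pos (ρ := fun i => ρ (k + i)) (x := fun i => x (k + i)) hρ hx
  simp only [chainValue, Finset.centerMass, smul_eq_mul, Finset.sum_Ico_eq_sum_range,
    add_assoc k n, Nat.add_sub_cancel_left, chainWeight_add, mul_assoc]
  rw [← Finset.mul_sum, ← Finset.mul_sum, mul_inv, mul_assoc, mul_left_comm _ (chainWeight ρ x k),
    inv_mul_cancel_left₀ hk, ← mul_right_inj' hW.ne', mul_sub, mul_inv_cancel_left₀ hW.ne',
    mul_inv_cancel_left₀ hW.ne', Finset.sum_mul, ← Finset.sum_sub_distrib]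
  refine Finset.sum_congr rfl fun i _ => ?_
  push_cast
  ring

lemma chainValue_static_drop_le {a : ℝ} (h₀ : g 0 = 0) (hc : 0 ≤ c) (ha : 0 ≤ a) (hga : 0 ≤ g a)
    (hρ : ∀ i < k + n, 0 < ρ (i + 1)) :
    chainValue g c (fun i => ρ (k + i)) (staticRate a n) n - c * k ≤
      chainValue g c ρ (staticRate a (k + n)) (k + n) := by
  rcases ha.eq_or_lt with rfl | ha
  · have hrate (m : ℕ) : staticRate 0 m = 0 := funext fun i => ite_self 0
    have hck : 0 ≤ c * k := by positivity
    rw [hrate, hrate, chainValue_eq_zero h₀ rfl, chainValue_eq_zero h₀ rfl, zero_sub]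
    exact neg_nonpos.2 hck
  have hx (i) (hi : i < k + n) : 0 < staticRate a (k + n) i := by rwa [staticRate_of_lt hi]
  have hw (i) (hi : i ≤ k + n) : 0 < chainWeight ρ (staticRate a (k + n)) i :=
    chainWeight_pos (fun j hj => hρ j (by omega)) fun j hj => hx j (by omega)
  have hshift : staticRate a n = fun i => staticRate a (k + n) (k + i) := by
    funext i
    simp only [staticRate, add_lt_add_iff_left]
  rw [hshift, chainValue_shift (fun i hi => hρ (k + i) (by omega))
    (fun i hi => (hx (k + i) (by omega)).le) (hw k (by omega)).ne']
  refine centerMass_Ico_le_centerMass_range (by omega) (fun i hi => hw i (by omega))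
    (antitone_static_reward h₀ hc hga _)

end ChainValue

/-! ### The Bellman inequalities of a birth-death chain -/

lemma exists_backward_recursion {α : Type*} (f : ℕ → α → α) (n : ℕ) (a : α) :
    ∃ δ : ℕ → α, (∀ i, n < i → δ i = a) ∧ ∀ i ≤ n, δ i = f i (δ (i + 1)) := by
  let d : ℕ → α := fun k => Nat.rec a (fun j b => f (n - j) b) k
  refine ⟨fun i => d (n + 1 - i), fun i hi => ?_, fun i hi => ?_⟩
  · change d (n + 1 - i) = d 0
    rw [Nat.sub_eq_zero_of_le hi]
  · change d (n + 1 - i) = f i (d (n + 1 - (i + 1)))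
    rw [show n + 1 - i = n - i + 1 by omega, Nat.add_sub_add_right]
    change f (n - (n - i)) (d (n - i)) = f i (d (n - i))
    rw [Nat.sub_sub_self hi]

section Bellman

variable {g : ℝ → ℝ} {c b F : ℝ} {ρ : ℕ → ℝ} {n : ℕ} {V : ℝ}

lemma exists_isMaxOn_netRevenue (hb : 0 ≤ b) (hg : ContinuousOn g (Icc 0 b)) (h₀ : g 0 = 0)
    (hgF : ∀ a ∈ Icc 0 b, g a ≤ a * F) (y : ℝ) :
    ∃ x ∈ Icc 0 b, IsMaxOn (fun a => g a - a * y) (Icc 0 b) x ∧ (F ≤ y → x = 0) := by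
  by_cases hy : F ≤ y
  · refine ⟨0, ⟨le_rfl, hb⟩, fun a ha => ?_, fun _ => rfl⟩
    have := (hgF a ha).trans (mul_le_mul_of_nonneg_left hy ha.1)
    simpa [h₀] using this
  · obtain ⟨x, hx, hmax⟩ := isCompact_Icc.exists_isMaxOn (nonempty_Icc.2 hb)
      (hg.sub (continuousOn_id.mul continuousOn_const))
    exact ⟨x, hx, hmax, fun h => absurd h hy⟩

/-- Solving the Bellman equation in state `i` for `δ i`, cut off at `0` and at `F`. -/
def clampedPrice (c F V : ℝ) (ρ : ℕ → ℝ) (i : ℕ) (h : ℝ) : ℝ :=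
  max 0 (min F ((V + c * i - h) / ρ i))

lemma clampedPrice_mem (hF : 0 ≤ F) (i : ℕ) (h : ℝ) : clampedPrice c F V ρ i h ∈ Icc 0 F :=
  ⟨le_max_left _ _, max_le hF (min_le_left _ _)⟩

lemma mul_clampedPrice_le {i : ℕ} {h : ℝ} (hρ : 0 < ρ i) (hh : h ≤ V + c * i) :
    ρ i * clampedPrice c F V ρ i h ≤ V + c * i - h := by
  have hraw : 0 ≤ (V + c * i - h) / ρ i := div_nonneg (sub_nonneg.2 hh) hρ.le
  rw [← le_div_iff₀' hρ]
  exact max_le hraw (min_le_right _ _)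

lemma le_mul_clampedPrice {i : ℕ} {h : ℝ} (hρ : 0 < ρ i) (hF : clampedPrice c F V ρ i h < F) :
    V + c * i - h ≤ ρ i * clampedPrice c F V ρ i h := by
  rw [← div_le_iff₀' hρ]
  have hmin : min F ((V + c * i - h) / ρ i) < F := (le_max_right _ _).trans_lt hF
  rw [clampedPrice, min_eq_right (by by_contra! h; simp [h.le] at hmin)]
  exact le_max_right _ _

lemma clampedPrice_eq_zero {i : ℕ} {h : ℝ} (hρ : 0 < ρ i) (hh : V + c * i < h) :
    clampedPrice c F V ρ i h = 0 :=
  max_eq_left ((min_le_right _ _).trans (div_nonpos_of_nonpos_of_nonneg (by linarith) hρ.le))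

/-- The greedy pricing `A` rejects below every state where `δ` is cut off at `F`, so a violation in
state `0` would make it earn more than `V`. -/
lemma greedy_zero_le (hρ₀ : ρ 0 = 0)
    (hρ : ∀ i < n, 0 < ρ (i + 1)) {A δ : ℕ → ℝ} (hA : ∀ i, 0 ≤ A i)
    (hAF : ∀ i, F ≤ δ (i + 1) → A i = 0) (hδn : δ (n + 1) = F)
    (hδ : ∀ i ≤ n, δ i = clampedPrice c F V ρ i (g (A i) - A i * δ (i + 1)))
    (hV : chainValue g c ρ A n ≤ V) : g (A 0) - A 0 * δ 1 ≤ V := by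
  have hsum := sum_chainWeight_mul_slack (g := g) (c := c) hρ₀ hρ (fun i _ => hA i)
    (hAF n hδn.ge) V δ
  by_contra! hneg
  refine (mul_nonneg (sub_nonneg.2 hV) (sum_chainWeight_pos hρ fun i _ => hA i).le).not_gt
    (hsum ▸ ?_)
  have hterm (i) (hi : i < n) : chainWeight ρ A (i + 1) * (V + c * (i + 1 : ℕ) -
      (g (A (i + 1)) - A (i + 1) * δ (i + 1 + 1) + ρ (i + 1) * δ (i + 1))) ≤ 0 := by
    rcases lt_or_ge (δ (i + 1)) F with hlt | hge
    · rw [hδ (i + 1) hi] at hlt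
      have := le_mul_clampedPrice (hρ i hi) hlt
      rw [← hδ (i + 1) hi] at this
      exact mul_nonpos_of_nonneg_of_nonpos
        (chainWeight_nonneg (fun j hj => hρ j (by omega)) fun j _ => hA j) (by linarith)
    · rw [chainWeight_eq_zero (hAF i hge) (Nat.lt_succ_self i), zero_mul]
  rw [Finset.sum_range_succ']
  refine add_neg_of_nonpos_of_neg
    (Finset.sum_nonpos fun i hi => hterm i (Finset.mem_range.1 hi)) ?_
  simpa [chainWeight_zero, hρ₀] using hneg

lemma greedy_le (hc : 0 ≤ c) (hρ₀ : ρ 0 = 0) (hρ : ∀ i < n, 0 < ρ (i + 1)) {A δ : ℕ → ℝ}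
    (hA : ∀ i, A i ∈ Icc 0 b)
    (hmax : ∀ i, IsMaxOn (fun a => g a - a * δ (i + 1)) (Icc 0 b) (A i))
    (hAF : ∀ i, F ≤ δ (i + 1) → A i = 0) (hδ₀ : ∀ i, 0 ≤ δ i) (hδn : δ (n + 1) = F)
    (hδ : ∀ i ≤ n, δ i = clampedPrice c F V ρ i (g (A i) - A i * δ (i + 1)))
    (hV : chainValue g c ρ A n ≤ V) : ∀ i ≤ n, g (A i) - A i * δ (i + 1) ≤ V + c * i := by
  intro i
  induction i with
  | zero =>
    intro _
    rw [Nat.cast_zero, mul_zero, add_zero]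
    exact greedy_zero_le hρ₀ hρ (fun i => (hA i).1) hAF hδn hδ hV
  | succ i ih =>
    intro hi
    by_contra! hgt
    have hzero : δ (i + 1) = 0 := (hδ (i + 1) hi).trans (clampedPrice_eq_zero (hρ i hi) hgt)
    have hstep := ih (by omega)
    have hbetter : g (A (i + 1)) - A (i + 1) * δ (i + 1) ≤ g (A i) - A i * δ (i + 1) :=
      hmax i (hA (i + 1))
    have hdiscount := mul_nonneg (hA (i + 1)).1 (hδ₀ (i + 1 + 1))
    rw [hzero] at hbetter hstep
    push_cast at hgt
    linarith

/-- Here `δ i` is the loss of relative value when the `i`-th rider joins. -/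
theorem exists_bellman (hc : 0 ≤ c) (hb : 0 ≤ b) (hF : 0 ≤ F) (hg : ContinuousOn g (Icc 0 b))
    (h₀ : g 0 = 0) (hgF : ∀ a ∈ Icc 0 b, g a ≤ a * F) (hρ₀ : ρ 0 = 0)
    (hρ : ∀ i < n, 0 < ρ (i + 1))
    (hV : ∀ x : ℕ → ℝ, (∀ i, x i ∈ Icc 0 b) → x n = 0 → chainValue g c ρ x n ≤ V) :
    ∃ δ : ℕ → ℝ, (∀ i, δ i ∈ Icc 0 F) ∧
      ∀ i ≤ n, ∀ a ∈ Icc 0 b, g a - a * δ (i + 1) + ρ i * δ i ≤ V + c * i := by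
  choose A hAmem hAmax hAF using exists_isMaxOn_netRevenue hb hg h₀ hgF
  obtain ⟨δ, hδn, hδ⟩ := exists_backward_recursion
    (fun i y => clampedPrice c F V ρ i (g (A y) - A y * y)) n F
  have hδmem (i : ℕ) : δ i ∈ Icc 0 F := by
    rcases le_or_gt i n with hi | hi
    · rw [hδ i hi]
      exact clampedPrice_mem hF _ _
    · rw [hδn i hi]
      exact ⟨hF, le_rfl⟩
  have hgain := greedy_le hc hρ₀ hρ (fun i => hAmem _) (fun i => hAmax _) (fun i => hAF _)
    (fun i => (hδmem i).1) (hδn _ n.lt_succ_self) hδ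
    (hV _ (fun i => hAmem _) (hAF _ (hδn _ n.lt_succ_self).ge))
  refine ⟨δ, hδmem, fun i hi a ha => ?_⟩
  have hmax : g a - a * δ (i + 1) ≤ g (A (δ (i + 1))) - A (δ (i + 1)) * δ (i + 1) :=
    hAmax (δ (i + 1)) ha
  rcases i with _ | i
  · rw [hρ₀, zero_mul, add_zero]
    exact hmax.trans (hgain 0 hi)
  · have hflow := mul_clampedPrice_le (F := F) (hρ i hi) (hgain (i + 1) hi)
    rw [← hδ (i + 1) hi] at hflow
    linarith

end Bellman

/-! ### Levels -/

/-- The states with `n` riders in the system, in service or in the queue. -/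
def level (n : ℕ) : Finset State := Finset.HasAntidiagonal.antidiagonal n

lemma mem_level {n : ℕ} {s : State} : s ∈ level n ↔ s.1 + s.2 = n :=
  Finset.HasAntidiagonal.mem_antidiagonal

lemma level_zero : level 0 = {(0, 0)} := rfl

lemma hasSum_sum_level {f : State → ℝ} {a : ℝ} (h : HasSum f a) :
    HasSum (fun n => ∑ s ∈ level n, f s) a := by
  rw [← Finset.HasAntidiagonal.sigmaAntidiagonalEquivProd.hasSum_iff] at h
  refine h.sigma fun n => ?_
  rw [← Finset.sum_coe_sort]
  exact hasSum_fintype _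

lemma settle_level (φ : State → Bool) (l m : ℕ) :
    (settle φ l m).1 + (settle φ l m).2 = l + m := by
  induction m generalizing l with
  | zero => rfl
  | succ m ih =>
    unfold settle
    split_ifs
    · rw [ih]; ring
    · rfl

namespace Model

variable (D : Model)

/-! ### Pricing and service -/

/-- Revenue rate at effective request rate `x`. -/
def revenue (x : ℝ) : ℝ := x * D.fare x

lemma unitPrice_spec {x : ℝ} (hx : x ∈ Icc 0 D.Lam) :
    D.unitPrice x ∈ Icc 0 D.pMax ∧ D.Lam * (1 - D.F (D.unitPrice x)) = x := by
  have hLam := D.Lam_pos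
  have hquantile : 1 - x / D.Lam ∈ Icc (0 : ℝ) 1 :=
    ⟨sub_nonneg.2 (div_le_one_of_le₀ hx.2 hLam.le), sub_le_self _ (div_nonneg hx.1 hLam.le)⟩
  obtain ⟨p, hp, hFp⟩ := D.F_surj hquantile
  have hex : ∃ p ∈ Icc 0 D.pMax, (fun p => D.Lam * (1 - D.F p)) p = x :=
    ⟨p, hp, by simp only [hFp]; field_simp; ring⟩
  exact ⟨Function.invFunOn_mem hex, Function.invFunOn_eq hex⟩

lemma antitoneOn_unitPrice : AntitoneOn D.unitPrice (Icc 0 D.Lam) := by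
  intro x hx y hy hxy
  by_contra! hlt
  obtain ⟨hpx, hxeq⟩ := D.unitPrice_spec hx
  obtain ⟨hpy, hyeq⟩ := D.unitPrice_spec hy
  have := mul_lt_mul_of_pos_left (D.F_strictMono hpx hpy hlt) D.Lam_pos
  linarith

lemma surjOn_unitPrice : SurjOn D.unitPrice (Icc 0 D.Lam) (Icc 0 D.pMax) := by
  intro p hp
  have hF := D.F_strictMono.monotoneOn
  have hF₀ := hF ⟨le_rfl, D.pMax_pos.le⟩ hp hp.1
  have hF₁ := hF hp ⟨D.pMax_pos.le, le_rfl⟩ hp.2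
  rw [D.F_zero] at hF₀
  rw [D.F_pMax] at hF₁
  have hx : D.Lam * (1 - D.F p) ∈ Icc 0 D.Lam :=
    ⟨mul_nonneg D.Lam_pos.le (by linarith), mul_le_of_le_one_right D.Lam_pos.le (by linarith)⟩
  obtain ⟨hmem, heq⟩ := D.unitPrice_spec hx
  refine ⟨_, hx, D.F_strictMono.injOn hmem hp ?_⟩
  linarith [mul_left_cancel₀ D.Lam_pos.ne' heq]

/-- A monotone map onto an interval has no jumps; reflecting `[0, Λ]` makes the price monotone. -/
lemma continuousOn_unitPrice : ContinuousOn D.unitPrice (Icc 0 D.Lam) := by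
  have hrefl (x : Icc 0 D.Lam) : D.Lam - x ∈ Icc 0 D.Lam :=
    ⟨sub_nonneg.2 x.2.2, sub_le_self _ x.2.1⟩
  let f (x : Icc 0 D.Lam) : Icc 0 D.pMax :=
    ⟨D.unitPrice (D.Lam - x), (D.unitPrice_spec (hrefl x)).1⟩
  have hmono : Monotone f := fun x y hxy =>
    D.antitoneOn_unitPrice (hrefl y) (hrefl x) (sub_le_sub_left (Subtype.coe_le_coe.2 hxy) _)
  have hsurj : Function.Surjective f := by
    rintro ⟨p, hp⟩
    obtain ⟨x, hx, rfl⟩ := D.surjOn_unitPrice hp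
    exact ⟨⟨D.Lam - x, hrefl ⟨x, hx⟩⟩, Subtype.ext (by simp [f])⟩
  have hcomp : Continuous fun x : Icc 0 D.Lam => f ⟨D.Lam - x, hrefl x⟩ :=
    (hmono.continuous_of_surjective hsurj).comp (by fun_prop)
  rw [continuousOn_iff_continuous_domRestrict]
  exact (continuous_subtype_val.comp hcomp).congr fun x => by simp [f]

lemma fare_nonneg {x : ℝ} (hx : x ∈ Icc 0 D.Lam) : 0 ≤ D.fare x :=
  add_nonneg (add_nonneg D.p0_nonneg (mul_pos D.wPR_pos D.t0_pos).le)
    (mul_nonneg (D.unitPrice_spec hx).1.1 D.t0_pos.le)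

lemma fareMax_pos : 0 < D.fareMax :=
  add_pos (add_pos_of_nonneg_of_pos D.p0_nonneg (mul_pos D.wPR_pos D.t0_pos))
    (mul_pos D.pMax_pos D.t0_pos)

lemma fare_le {x : ℝ} (hx : x ∈ Icc 0 D.Lam) : D.fare x ≤ D.fareMax :=
  add_le_add_right (mul_le_mul_of_nonneg_right (D.unitPrice_spec hx).1.2 D.t0_pos.le) _

lemma fare_lt {x : ℝ} (hx : x ∈ Icc 0 D.Lam) (h₀ : 0 < x) : D.fare x < D.fareMax := by
  obtain ⟨hmem, heq⟩ := D.unitPrice_spec hx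
  have hne : D.unitPrice x ≠ D.pMax := fun h => by
    rw [h, D.F_pMax, sub_self, mul_zero] at heq
    exact h₀.ne heq
  exact add_lt_add_right (mul_lt_mul_of_pos_right (hmem.2.lt_of_ne hne) D.t0_pos) _

lemma revenue_zero : D.revenue 0 = 0 := zero_mul _

lemma revenue_nonneg {x : ℝ} (hx : x ∈ Icc 0 D.Lam) : 0 ≤ D.revenue x :=
  mul_nonneg hx.1 (D.fare_nonneg hx)

lemma continuousOn_revenue : ContinuousOn D.revenue (Icc 0 D.Lam) :=
  continuousOn_id.mul (continuousOn_const.add (D.continuousOn_unitPrice.mul continuousOn_const))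

lemma revenue_le_mul_fareMax {x : ℝ} (hx : x ∈ Icc 0 D.Lam) : D.revenue x ≤ x * D.fareMax :=
  mul_le_mul_of_nonneg_left (D.fare_le hx) hx.1

lemma revenue_le {x : ℝ} (hx : x ∈ Icc 0 D.Lam) : D.revenue x ≤ D.Lam * D.fareMax :=
  (D.revenue_le_mul_fareMax hx).trans (mul_le_mul_of_nonneg_right hx.2 D.fareMax_pos.le)

lemma cr_pos : 0 < D.cr := D.wQR_pos

lemma serviceRate_zero (m : ℕ) : D.serviceRate (0, m) = 0 := by simp [serviceRate]

lemma serviceRate_pos {l : ℕ} (m : ℕ) (h₀ : 0 < l) (hl : l ≤ D.L) : 0 < D.serviceRate (l, m) :=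
  mul_pos (Nat.cast_pos.2 h₀) (D.mu_pos l hl m)

lemma serviceRate_nonneg {l : ℕ} (m : ℕ) (hl : l ≤ D.L) : 0 ≤ D.serviceRate (l, m) :=
  mul_nonneg (Nat.cast_nonneg l) (D.mu_pos l hl m).le

lemma serviceRate_le {l : ℕ} (m : ℕ) (hl : l ≤ D.L) : D.serviceRate (l, m) ≤ D.L * D.muBar :=
  mul_le_mul (Nat.cast_le.2 hl) (D.mu_le l hl m) (D.mu_pos l hl m).le (Nat.cast_nonneg _)

/-! ### Types of states and the zigzag path -/

/-- The qualitative form of diminishing returns: type 2 persists when riders join the queue and when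
drivers leave service. -/
structure MonotoneTypes : Prop where
  monotone_type2 : ∀ l, Monotone fun m => D.Type2 (l, m)
  antitone_type2 : ∀ m, Antitone fun l => D.Type2 (l, m)

variable {D} in
lemma DiminishingReturns.monotoneTypes (hD : D.DiminishingReturns) : D.MonotoneTypes where
  monotone_type2 l := by
    refine monotone_nat_of_le_succ fun m ⟨hl, hm, hrate⟩ => ⟨hl, m.succ_ne_zero, ?_⟩
    obtain ⟨k, rfl⟩ := Nat.exists_eq_succ_of_ne_zero hm
    have hanti := hD.incr_m_anti_m l hl.le k.le_succ
    have hmono := hD.incr_m_mono_l k (mem_Iic.2 hl.le) (mem_Iic.2 hl) l.le_succ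
    simp only [Nat.succ_eq_add_one, Nat.add_sub_cancel] at *
    linarith
  antitone_type2 m := by
    refine antitone_nat_of_succ_le fun l ⟨hl, hm, hrate⟩ => ?_
    obtain ⟨k, rfl⟩ := Nat.exists_eq_succ_of_ne_zero hm
    have hlt : l < D.L := l.lt_succ_self.trans hl
    refine ⟨hlt, hm, ?_⟩
    have hanti := hD.incr_l_anti_l k (mem_Iio.2 hlt) (mem_Iio.2 hl) l.le_succ
    have hmono := hD.incr_l_mono_m l hlt k.le_succ
    simp only [Nat.succ_eq_add_one, Nat.add_sub_cancel] at *
    linarith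

lemma type1_iff_not_type2 {l m : ℕ} (hl : l ≤ D.L) : D.Type1 (l, m) ↔ ¬ D.Type2 (l, m) := by
  simp only [Type1, Type2, not_and, not_le, hl.lt_iff_ne]
  tauto

lemma typeRule_eq_true {s : State} : D.typeRule s = true ↔ D.Type2 s := by
  simp [typeRule]

/-- The number of busy drivers in the `n`-th state of the zigzag path of the type rule. -/
def busy (n : ℕ) : ℕ := (zigzag D.typeRule n).1

lemma zigzag_level (φ : State → Bool) (n : ℕ) : (zigzag φ n).1 + (zigzag φ n).2 = n := by
  induction n with
  | zero => rfl
  | succ n ih =>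
    simp only [zigzag]
    split_ifs <;> simp only <;> omega

lemma zigzag_typeRule (n : ℕ) : zigzag D.typeRule n = (D.busy n, n - D.busy n) :=
  Prod.ext rfl (Nat.eq_sub_of_add_eq' (zigzag_level D.typeRule n))

lemma busy_le (n : ℕ) : D.busy n ≤ n := Nat.le.intro (zigzag_level D.typeRule n)

lemma busy_zero : D.busy 0 = 0 := rfl

open Classical in
lemma busy_succ (n : ℕ) : D.busy (n + 1) =
    if D.Type2 (D.busy n, n + 1 - D.busy n) then D.busy n + 1 else D.busy n := by
  conv_lhs => rw [busy, zigzag, D.zigzag_typeRule n]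
  simp only [← Nat.sub_add_comm (D.busy_le n), D.typeRule_eq_true]
  split_ifs <;> rfl

lemma busy_le_L (n : ℕ) : D.busy n ≤ D.L := by
  induction n with
  | zero => exact Nat.zero_le _
  | succ n ih =>
    rw [busy_succ]
    split_ifs with h
    · exact h.1
    · exact ih

lemma monotone_busy : Monotone D.busy :=
  monotone_nat_of_le_succ fun n => by rw [busy_succ]; split_ifs <;> omega

lemma busy_succ_le (n : ℕ) : D.busy (n + 1) ≤ D.busy n + 1 := by
  rw [busy_succ]
  split_ifs <;> omega

lemma busy_add_le (n k : ℕ) : D.busy (n + k) ≤ D.busy n + k := by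
  induction k with
  | zero => exact le_rfl
  | succ k ih => exact (D.busy_succ_le (n + k)).trans (Nat.succ_le_succ ih)

lemma one_le_busy {n : ℕ} (hn : 1 ≤ n) : 1 ≤ D.busy n := by
  refine le_trans ?_ (D.monotone_busy hn)
  rw [busy_succ, busy_zero, if_pos]
  refine ⟨D.one_le_L, one_ne_zero, ?_⟩
  rw [serviceRate_zero]
  exact D.serviceRate_nonneg _ D.one_le_L

lemma exists_busy_eq {l m : ℕ} (h : l < D.busy (l + m)) : ∃ j < m, D.busy (l + j) = l := by
  induction m with
  | zero => exact absurd (D.busy_le l) (not_le.2 h)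
  | succ m ih =>
    have hstep := D.busy_succ_le (l + m)
    rw [← add_assoc] at h
    rcases (Nat.lt_succ_iff.1 (h.trans_le hstep)).eq_or_lt with heq | hlt
    · exact ⟨m, m.lt_succ_self, heq.symm⟩
    · obtain ⟨j, hj, hbusy⟩ := ih hlt
      exact ⟨j, hj.trans m.lt_succ_self, hbusy⟩

namespace MonotoneTypes

variable {D} (hD : D.MonotoneTypes) {l m : ℕ}
include hD

lemma type2_iff : D.Type2 (l, m) ↔ l < D.busy (l + m) := by
  obtain ⟨n, hn⟩ : ∃ n, l + m = n := ⟨_, rfl⟩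
  rw [hn]
  induction n generalizing l m with
  | zero =>
    obtain rfl : m = 0 := by omega
    simp [Type2, busy_zero]
  | succ n ih =>
    have hle := D.busy_le n
    have hstep := D.busy_succ_le n
    have hmono := D.monotone_busy n.le_succ
    rcases lt_trichotomy l (D.busy n) with hlt | rfl | hgt
    · refine iff_of_true (hD.monotone_type2 l (show n - l ≤ m by omega) ?_) (hlt.trans_le hmono)
      exact (ih (by omega)).2 hlt
    · rw [busy_succ, show n + 1 - D.busy n = m by omega]
      split_ifs with htype <;> simp [htype]
    · refine iff_of_false (fun htype => ?_) (by omega)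
      have htype' : D.Type2 (D.busy n, n - D.busy n) :=
        hD.monotone_type2 _ (by omega) (hD.antitone_type2 m hgt.le htype)
      exact lt_irrefl _ ((ih (by omega)).1 htype')

lemma type1_iff (hl : l ≤ D.L) : D.Type1 (l, m) ↔ D.busy (l + m) ≤ l := by
  rw [D.type1_iff_not_type2 hl, hD.type2_iff, not_lt]

lemma monotoneOn_serviceRate_level (n : ℕ) :
    MonotoneOn (fun l => D.serviceRate (l, n - l)) (Iic (D.busy n)) := by
  refine monotoneOn_of_le_succ ordConnected_Iic fun l _ _ hl => ?_
  rw [Nat.succ_eq_succ, mem_Iic] at hl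
  have htype : D.Type2 (l, n - l) := by
    have := D.busy_le n
    rwa [hD.type2_iff, show l + (n - l) = n by omega]
  exact htype.2.2

lemma antitoneOn_serviceRate_level (n : ℕ) :
    AntitoneOn (fun l => D.serviceRate (l, n - l)) (Icc (D.busy n) (min n D.L)) := by
  refine antitoneOn_of_succ_le ordConnected_Icc fun l _ hl hl' => ?_
  rw [Nat.succ_eq_succ, mem_Icc, le_min_iff] at hl'
  have htype : D.Type1 (l, n - l) := by
    rw [hD.type1_iff (by omega), show l + (n - l) = n by omega]
    exact hl.1
  rcases htype with h | h | h
  · exact absurd h (by simp only; omega)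
  · exact absurd h (by simp only; omega)
  · exact h.le

end MonotoneTypes

/-! ### The zigzag path, clipped to a box -/

/-- Busy drivers in the state of level `i` nearest to the zigzag path in the box
`[0, a] × [0, b]`. -/
def clipBusy (a b i : ℕ) : ℕ := max (i - b) (min a (D.busy i))

/-- The state of level `i` nearest to the zigzag path in the box `[0, a] × [0, b]`. -/
def clip (a b i : ℕ) : State := (D.clipBusy a b i, i - D.clipBusy a b i)

/-- The zigzag path, clipped to the box `[0, a] × [0, b]`. -/
def boxPath (a b : ℕ) : List State := (List.range (a + b + 1)).map (D.clip a b)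

section Clip

variable {a b i : ℕ}

lemma clipBusy_le (a b i : ℕ) : D.clipBusy a b i ≤ i :=
  max_le (Nat.sub_le ..) ((min_le_right ..).trans (D.busy_le i))

lemma clip_level (a b i : ℕ) : (D.clip a b i).1 + (D.clip a b i).2 = i :=
  Nat.add_sub_cancel' (D.clipBusy_le a b i)

lemma clip_fst_le (h : i ≤ a + b) : (D.clip a b i).1 ≤ a :=
  max_le (Nat.sub_le_iff_le_add.2 h) (min_le_left ..)

lemma clip_snd_le (a b i : ℕ) : (D.clip a b i).2 ≤ b := by
  simp only [clip, clipBusy]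
  omega

lemma one_le_clip_fst (ha : 1 ≤ a) (hi : 1 ≤ i) : 1 ≤ (D.clip a b i).1 :=
  le_max_of_le_right (le_min ha (D.one_le_busy hi))

lemma clip_eq_mk {l m : ℕ} (hfst : D.clipBusy a b i = l) (hlevel : l + m = i) :
    D.clip a b i = (l, m) := by
  rw [clip, hfst, ← hlevel, Nat.add_sub_cancel_left]

lemma clip_zero (a b : ℕ) : D.clip a b 0 = (0, 0) := by
  simp [clip, clipBusy, busy_zero]

lemma clip_last (a b : ℕ) : D.clip a b (a + b) = (a, b) := by
  refine D.clip_eq_mk ?_ rfl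
  unfold clipBusy
  omega

lemma clip_eq_zigzag (hfst : D.busy i ≤ a) (hsnd : i - D.busy i ≤ b) :
    D.clip a b i = zigzag D.typeRule i := by
  have hbusy : D.clipBusy a b i = D.busy i := by unfold clipBusy; omega
  rw [clip, hbusy, zigzag_typeRule]

lemma clip_firstColumn (hi : i ≤ a) : D.clip a 0 i = (i, 0) := by
  refine D.clip_eq_mk ?_ i.add_zero
  have := D.busy_le i
  unfold clipBusy
  omega

lemma length_boxPath (a b : ℕ) : (D.boxPath a b).length = a + b + 1 := by simp [boxPath]

lemma getElem?_boxPath (h : i ≤ a + b) : (D.boxPath a b)[i]? = some (D.clip a b i) := by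
  rw [boxPath, List.getElem?_map, List.getElem?_range (by omega), Option.map_some]

lemma nth_boxPath (h : i ≤ a + b) : nth (D.boxPath a b) i = D.clip a b i := by
  rw [nth, List.getD_eq_getElem?_getD, D.getElem?_boxPath h, Option.getD_some]

lemma mem_boxPath {s : State} :
    s ∈ D.boxPath a b ↔ s.1 + s.2 ≤ a + b ∧ s = D.clip a b (s.1 + s.2) := by
  simp only [boxPath, List.mem_map, List.mem_range, Nat.lt_succ_iff]
  constructor
  · rintro ⟨i, hi, rfl⟩
    rw [clip_level]
    exact ⟨hi, rfl⟩
  · rintro ⟨hlevel, hs⟩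
    exact ⟨_, hlevel, hs.symm⟩

end Clip

namespace MonotoneTypes

variable {D} (hD : D.MonotoneTypes) {a b l m i : ℕ}
include hD

lemma serviceRate_le_clip (ha : a ≤ D.L) (hl : l ≤ a) (hm : m ≤ b) :
    D.serviceRate (l, m) ≤ D.serviceRate (D.clip a b (l + m)) := by
  have hle := D.clipBusy_le a b (l + m)
  rw [show (l, m) = (l, l + m - l) by rw [Nat.add_sub_cancel_left], clip]
  by_cases hbusy : l ≤ D.busy (l + m)
  · by_cases hclip : D.clipBusy a b (l + m) ≤ D.busy (l + m)
    · refine hD.monotoneOn_serviceRate_level (l + m) hbusy hclip ?_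
      unfold clipBusy
      omega
    · have heq : D.clipBusy a b (l + m) = l := by
        unfold clipBusy at hclip ⊢
        omega
      rw [heq]
  · have hclip : D.busy (l + m) ≤ D.clipBusy a b (l + m) ∧ D.clipBusy a b (l + m) ≤ l := by
      unfold clipBusy
      omega
    exact hD.antitoneOn_serviceRate_level (l + m) ⟨hclip.1, by omega⟩
      ⟨(not_le.1 hbusy).le, by omega⟩ hclip.2

lemma clip_of_type2 (h : D.Type2 (l, m + 1)) (hi : i ≤ l + 1 + m) :
    D.clip (l + 1) (m + 1) i = D.clip (l + 1) m i := by
  rw [hD.type2_iff] at h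
  have hbusy := D.busy_add_le i (l + 1 + m - i)
  rw [show i + (l + 1 + m - i) = l + (m + 1) by omega] at hbusy
  have heq : D.clipBusy (l + 1) (m + 1) i = D.clipBusy (l + 1) m i := by unfold clipBusy; omega
  rw [clip, clip, heq]

lemma clip_of_type1 (hl : l ≤ D.L) (h : D.Type1 (l, m + 1)) (hi : i ≤ l + (m + 1)) :
    D.clip (l + 1) (m + 1) i = D.clip l (m + 1) i := by
  rw [hD.type1_iff hl] at h
  have hbusy := D.monotone_busy hi
  have heq : D.clipBusy (l + 1) (m + 1) i = D.clipBusy l (m + 1) i := by unfold clipBusy; omega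
  rw [clip, clip, heq]

end MonotoneTypes

/-! ### Values of paths -/

/-- A path whose `i`-th state, for `i ≤ n`, has `k + i` riders in the system, and in which some
driver is in service except perhaps at the start. -/
structure IsLevelPath (P : List State) (k n : ℕ) : Prop where
  length_eq : P.length = n + 1
  level_nth : ∀ i ≤ n, (nth P i).1 + (nth P i).2 = k + i
  fst_le : ∀ i ≤ n, (nth P i).1 ≤ D.L
  one_le_fst : ∀ i < n, 1 ≤ (nth P (i + 1)).1

/-- The total service rates along a path. -/
def pathService (P : List State) (i : ℕ) : ℝ := D.serviceRate (nth P i)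

lemma nth_append_left {P : List State} {s : State} {i : ℕ} (h : i < P.length) :
    nth (P ++ [s]) i = nth P i :=
  List.getD_append _ _ _ _ h

lemma nth_append_length (P : List State) (s : State) : nth (P ++ [s]) P.length = s := by
  rw [nth, List.getD_append_right _ _ _ _ le_rfl, Nat.sub_self, List.getD_cons_zero]

lemma reward_eq (hc : D.cd = D.cr) (x : ℝ) (s : State) :
    D.reward x s = D.revenue x - D.cr * (s.1 + s.2 : ℕ) := by
  rw [reward, hc, revenue]
  push_cast
  ring

lemma pathWeight_eq_chainWeight (P : List State) (x : State → ℝ) : D.pathWeight P x =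
    chainWeight (D.pathService P) (fun i => pathRate P x (nth P i)) := rfl

lemma isLevelPath_boxPath {a b : ℕ} (ha : 1 ≤ a ∨ b = 0) (hL : a ≤ D.L) :
    D.IsLevelPath (D.boxPath a b) 0 (a + b) where
  length_eq := D.length_boxPath a b
  level_nth i hi := by rw [D.nth_boxPath hi, clip_level, zero_add]
  fst_le i hi := by
    rw [D.nth_boxPath hi]
    exact (D.clip_fst_le hi).trans hL
  one_le_fst i hi := by
    rw [D.nth_boxPath hi]
    exact D.one_le_clip_fst (by omega) (by omega)

namespace IsLevelPath

variable {D} {P : List State} {k n i : ℕ} (h : D.IsLevelPath P k n)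
include h

lemma append {s : State} (hs : s.1 + s.2 = k + (n + 1)) (h₁ : 1 ≤ s.1) (hL : s.1 ≤ D.L) :
    D.IsLevelPath (P ++ [s]) k (n + 1) := by
  have hlen := h.length_eq
  have hleft (i) (hi : i ≤ n) : nth (P ++ [s]) i = nth P i :=
    nth_append_left (by rw [hlen]; exact Nat.lt_succ_of_le hi)
  have hlast : nth (P ++ [s]) (n + 1) = s := by rw [← hlen, nth_append_length]
  refine ⟨by rw [List.length_append, hlen, List.length_singleton], fun i hi => ?_, fun i hi => ?_,
    fun i hi => ?_⟩
  · rcases hi.eq_or_lt with rfl | hi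
    · rwa [hlast]
    · rw [hleft i (Nat.lt_succ_iff.1 hi)]
      exact h.level_nth i (Nat.lt_succ_iff.1 hi)
  · rcases hi.eq_or_lt with rfl | hi
    · rwa [hlast]
    · rw [hleft i (Nat.lt_succ_iff.1 hi)]
      exact h.fst_le i (Nat.lt_succ_iff.1 hi)
  · rcases (Nat.lt_succ_iff.1 hi).eq_or_lt with rfl | hi
    · rwa [hlast]
    · rw [hleft (i + 1) hi]
      exact h.one_le_fst i hi

lemma pathService_pos (hi : i < n) : 0 < D.pathService P (i + 1) :=
  D.serviceRate_pos _ (h.one_le_fst i hi) (h.fst_le (i + 1) hi)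

lemma nth_mem_dropLast (hi : i ≤ n) : nth P i ∈ P.dropLast ↔ i < n := by
  have hlen := h.length_eq
  have hnth (j) (hj : j < P.length) : P[j] = nth P j := (List.getD_eq_getElem _ _ hj).symm
  rw [List.mem_iff_getElem]
  simp only [List.length_dropLast, List.getElem_dropLast]
  constructor
  · rintro ⟨j, hj, heq⟩
    have hlevel := h.level_nth i hi
    rw [← heq, hnth, h.level_nth j (by omega)] at hlevel
    omega
  · exact fun hlt => ⟨i, by omega, hnth i _⟩

lemma pathRate_nth (hi : i ≤ n) (x : State → ℝ) :
    pathRate P x (nth P i) = if i < n then x (nth P i) else 0 := by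
  simp only [pathRate, h.nth_mem_dropLast hi]

lemma pathValue_eq (hc : D.cd = D.cr) {x : State → ℝ} (hx : ∀ s, 0 ≤ x s) :
    D.pathValue P x =
      chainValue D.revenue D.cr (D.pathService P) (fun i => pathRate P x (nth P i)) n -
        D.cr * k := by
  have hrate (i : ℕ) : 0 ≤ pathRate P x (nth P i) := by
    unfold pathRate
    split_ifs
    exacts [hx _, le_rfl]
  have hW := (sum_chainWeight_pos (fun i hi => h.pathService_pos hi) fun i _ => hrate i).ne'
  simp only [pathValue, pathWeight_eq_chainWeight, h.length_eq, chainValue, Finset.centerMass,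
    smul_eq_mul]
  rw [← mul_right_inj' hW, mul_sub, mul_inv_cancel_left₀ hW, Finset.mul_sum, Finset.sum_mul,
    ← Finset.sum_sub_distrib]
  refine Finset.sum_congr rfl fun i hi => ?_
  rw [D.reward_eq hc, h.level_nth i (Nat.lt_succ_iff.1 (Finset.mem_range.1 hi)), ← mul_assoc,
    mul_div_cancel₀ _ hW]
  push_cast
  ring

lemma pathValue_static (hc : D.cd = D.cr) {a : ℝ} (ha : 0 ≤ a) :
    D.pathValue P (fun _ => a) =
      chainValue D.revenue D.cr (D.pathService P) (staticRate a n) n - D.cr * k := by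
  rw [h.pathValue_eq hc fun _ => ha]
  congr 1
  exact chainValue_congr (fun _ _ => rfl) fun i hi => h.pathRate_nth hi _

end IsLevelPath

/-- The best objective of a birth-death chain under static pricing. -/
def chainStatic (ρ : ℕ → ℝ) (n : ℕ) : ℝ :=
  sSup ((fun a => chainValue D.revenue D.cr ρ (staticRate a n) n) '' Icc 0 D.Lam)

/-- The best objective under static pricing among the chains `{0, …, j}` with `j ≤ n`, which is what
the table records. -/
def chainBest (ρ : ℕ → ℝ) : ℕ → ℝ
  | 0 => 0
  | n + 1 => max (chainBest ρ n) (D.chainStatic ρ (n + 1))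

section ChainBest

variable {ρ ρ' : ℕ → ℝ} {n : ℕ}

lemma nonempty_rates : (Icc 0 D.Lam).Nonempty := nonempty_Icc.2 D.Lam_pos.le

lemma chainValue_le_chainStatic (hρ : ∀ i < n, 0 < ρ (i + 1)) {a : ℝ} (ha : a ∈ Icc 0 D.Lam) :
    chainValue D.revenue D.cr ρ (staticRate a n) n ≤ D.chainStatic ρ n := by
  refine le_csSup ⟨D.Lam * D.fareMax, ?_⟩ ⟨a, ha, rfl⟩
  rintro _ ⟨y, hy, rfl⟩
  exact chainValue_le D.cr_pos.le hρ (fun i _ => (staticRate_mem hy n i).1)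
    fun i _ => D.revenue_le (staticRate_mem hy n i)

lemma chainStatic_mono (hρ : ∀ i < n, 0 < ρ (i + 1)) (hle : ∀ i < n, ρ (i + 1) ≤ ρ' (i + 1)) :
    D.chainStatic ρ n ≤ D.chainStatic ρ' n := by
  refine csSup_le (D.nonempty_rates.image _) ?_
  rintro _ ⟨a, ha, rfl⟩
  exact (chainValue_static_mono D.revenue_zero D.cr_pos.le ha.1 (D.revenue_nonneg ha) hρ hle).trans
    (D.chainValue_le_chainStatic (fun i hi => (hρ i hi).trans_le (hle i hi)) ha)

lemma chainBest_nonneg (ρ : ℕ → ℝ) (n : ℕ) : 0 ≤ D.chainBest ρ n := by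
  induction n with
  | zero => exact le_rfl
  | succ n ih => exact ih.trans (le_max_left ..)

lemma chainBest_mono (hρ : ∀ i < n, 0 < ρ (i + 1)) (hle : ∀ i < n, ρ (i + 1) ≤ ρ' (i + 1)) :
    D.chainBest ρ n ≤ D.chainBest ρ' n := by
  induction n with
  | zero => exact le_rfl
  | succ n ih =>
    exact max_le_max (ih (fun i hi => hρ i (by omega)) fun i hi => hle i (by omega))
      (D.chainStatic_mono hρ hle)

lemma chainBest_congr (hρ : ∀ i < n, 0 < ρ (i + 1)) (heq : ∀ i < n, ρ (i + 1) = ρ' (i + 1)) :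
    D.chainBest ρ n = D.chainBest ρ' n :=
  (D.chainBest_mono hρ fun i hi => (heq i hi).le).antisymm <|
    D.chainBest_mono (fun i hi => heq i hi ▸ hρ i hi) fun i hi => (heq i hi).ge

end ChainBest

variable {D} in
lemma IsLevelPath.staticValue_eq (hc : D.cd = D.cr) {P : List State} {n : ℕ}
    (h : D.IsLevelPath P 0 n) : D.staticValue P = D.chainStatic (D.pathService P) n := by
  unfold staticValue chainStatic
  congr 1
  refine image_congr fun a ha => ?_
  simp only [h.pathValue_static hc ha.1, Nat.cast_zero, mul_zero, sub_zero]

/-! ### The table -/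

/-- The candidate entry at `s` when `c` is the entry before it. -/
def extend (c : Cell) (s : State) : Cell :=
  ⟨c.path ++ [s], max c.value (D.staticValue (c.path ++ [s]))⟩

lemma update_of_type1 {above left : Cell} {l m : ℕ} (h : D.Type1 (l, m))
    (hle : (D.extend left (l + 1, m)).value ≤ (D.extend above (l + 1, m)).value) :
    D.update above left l m = D.extend above (l + 1, m) := by
  simp only [update, extend, if_pos h] at hle ⊢
  rw [if_neg hle.not_gt]
  split_ifs with hlt
  · rfl
  · rw [hle.antisymm (not_lt.1 hlt)]

lemma update_of_not_type1 {above left : Cell} {l m : ℕ} (h : ¬ D.Type1 (l, m))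
    (hle : (D.extend above (l + 1, m)).value ≤ (D.extend left (l + 1, m)).value) :
    D.update above left l m = D.extend left (l + 1, m) := by
  simp only [update, extend, if_neg h] at hle ⊢
  rw [if_neg hle.not_gt, ite_self]

/-- The table entry that holds the clipped zigzag path. -/
def boxCell (a b : ℕ) : Cell :=
  ⟨D.boxPath a b, D.chainBest (D.pathService (D.boxPath a b)) (a + b)⟩

lemma boxPath_eq_append {a b a' b' : ℕ} (hab : a + b = a' + b' + 1)
    (hclip : ∀ i ≤ a' + b', D.clip a b i = D.clip a' b' i) :
    D.boxPath a b = D.boxPath a' b' ++ [(a, b)] := by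
  rw [boxPath, List.range_succ, List.map_append, List.map_singleton, clip_last, hab]
  congr 1
  exact List.map_congr_left fun i hi => hclip i (Nat.lt_succ_iff.1 (List.mem_range.1 hi))

section Extend

variable {a b a' b' : ℕ} (hc : D.cd = D.cr) (ha' : 1 ≤ a' ∨ b' = 0) (hL' : a' ≤ D.L)
  (ha : 1 ≤ a) (hL : a ≤ D.L) (hab : a + b = a' + b' + 1)
include ha' hL' ha hL hab

lemma isLevelPath_boxPath_append :
    D.IsLevelPath (D.boxPath a' b' ++ [(a, b)]) 0 (a' + b' + 1) :=
  (D.isLevelPath_boxPath ha' hL').append (by simp only; omega) ha hL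

include hc

lemma value_extend_boxCell : (D.extend (D.boxCell a' b') (a, b)).value =
    D.chainBest (D.pathService (D.boxPath a' b' ++ [(a, b)])) (a' + b' + 1) := by
  rw [chainBest, ← (D.isLevelPath_boxPath_append ha' hL' ha hL hab).staticValue_eq hc]
  refine congrArg (max · _) (D.chainBest_congr
    (fun i hi => (D.isLevelPath_boxPath ha' hL').pathService_pos hi) fun i hi => ?_)
  rw [pathService, pathService, nth_append_left (by rw [length_boxPath]; omega)]

lemma extend_boxCell (hclip : ∀ i ≤ a' + b', D.clip a b i = D.clip a' b' i) :
    D.extend (D.boxCell a' b') (a, b) = D.boxCell a b := by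
  have hvalue := D.value_extend_boxCell hc ha' hL' ha hL hab
  have hpath := D.boxPath_eq_append hab hclip
  rw [← hpath, ← hab] at hvalue
  exact (congrArg₂ Cell.mk hpath hvalue.symm).symm

variable {D} in
/-- In its box, the clipped zigzag path has the fastest service on every level. -/
lemma MonotoneTypes.value_extend_boxCell_le (hD : D.MonotoneTypes) (haa : a' ≤ a) (hbb : b' ≤ b) :
    (D.extend (D.boxCell a' b') (a, b)).value ≤ (D.boxCell a b).value := by
  have hP := D.isLevelPath_boxPath_append ha' hL' ha hL hab
  rw [D.value_extend_boxCell hc ha' hL' ha hL hab, boxCell, hab]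
  refine D.chainBest_mono (fun i hi => hP.pathService_pos hi) fun i hi => ?_
  have hbox : (nth (D.boxPath a' b' ++ [(a, b)]) (i + 1)).1 ≤ a ∧
      (nth (D.boxPath a' b' ++ [(a, b)]) (i + 1)).2 ≤ b := by
    rcases (Nat.lt_succ_iff.1 hi).eq_or_lt with rfl | hlt
    · rw [← D.length_boxPath, nth_append_length]
      exact ⟨le_rfl, le_rfl⟩
    · rw [nth_append_left (by rw [length_boxPath]; omega), D.nth_boxPath (by omega)]
      exact ⟨(D.clip_fst_le (by omega)).trans haa, (D.clip_snd_le ..).trans hbb⟩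
  have hle := hD.serviceRate_le_clip hL hbox.1 hbox.2
  rwa [hP.level_nth _ hi, zero_add, ← D.nth_boxPath (by omega)] at hle

end Extend

lemma firstColumn_eq_boxCell (hc : D.cd = D.cr) {l : ℕ} (hl : l ≤ D.L) :
    D.firstColumn l = D.boxCell l 0 := by
  induction l with
  | zero => simp [firstColumn, boxCell, boxPath, clip_zero, chainBest]
  | succ l ih =>
    change D.extend (D.firstColumn l) (l + 1, 0) = _
    rw [ih (by omega)]
    refine D.extend_boxCell hc (Or.inr rfl) (by omega) (by omega) hl rfl fun i hi => ?_
    rw [clip_firstColumn _ (by omega), clip_firstColumn _ (by omega)]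

/-- The path above a cell of row one starts at `(0, m + 1)`; it is no better than the clipped zigzag
path, which passes through levels `0, …, m` first. -/
lemma value_extend_singleton_le (hc : D.cd = D.cr) (m : ℕ) :
    (D.extend ⟨[(0, m + 1)], 0⟩ (1, m + 1)).value ≤ (D.boxCell 1 (m + 1)).value := by
  refine max_le (D.chainBest_nonneg _ _) (csSup_le (D.nonempty_rates.image _) ?_)
  rintro _ ⟨a, ha, rfl⟩
  have hshort : D.IsLevelPath [(0, m + 1), (1, m + 1)] (m + 1) 1 := by
    refine ⟨rfl, fun i hi => ?_, fun i hi => ?_, fun i hi => ?_⟩ <;> interval_cases i <;>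
      simp [nth, D.one_le_L, add_comm]
  have hbox := D.isLevelPath_boxPath (b := m + 1) (Or.inl le_rfl) D.one_le_L
  rw [add_comm 1] at hbox
  have hdrop := chainValue_static_drop_le D.revenue_zero D.cr_pos.le ha.1 (D.revenue_nonneg ha)
    fun i hi => hbox.pathService_pos hi
  calc D.pathValue [(0, m + 1), (1, m + 1)] (fun _ => a)
      = chainValue D.revenue D.cr (fun i => D.pathService (D.boxPath 1 (m + 1)) (m + 1 + i))
          (staticRate a 1) 1 - D.cr * (m + 1 : ℕ) := by
        rw [hshort.pathValue_static hc ha.1]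
        congr 1
        refine chainValue_congr (fun i hi => ?_) fun _ _ => rfl
        obtain rfl : i = 0 := by omega
        rw [pathService, pathService, D.nth_boxPath (by omega), zero_add, add_comm (m + 1),
          clip_last]
        rfl
    _ ≤ D.chainStatic (D.pathService (D.boxPath 1 (m + 1))) (m + 1 + 1) :=
        hdrop.trans (D.chainValue_le_chainStatic (fun i hi => hbox.pathService_pos hi) ha)
    _ ≤ (D.boxCell 1 (m + 1)).value := by
        rw [boxCell, add_comm 1]
        exact le_max_right _ _

namespace MonotoneTypes

variable {D} (hD : D.MonotoneTypes) (hc : D.cd = D.cr) {l m : ℕ}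
include hD hc

lemma update_of_type2 {above : Cell} (hl : l + 1 ≤ D.L) (h : D.Type2 (l, m + 1))
    (hle : (D.extend above (l + 1, m + 1)).value ≤ (D.boxCell (l + 1) (m + 1)).value) :
    D.update above (D.boxCell (l + 1) m) l (m + 1) = D.boxCell (l + 1) (m + 1) := by
  have hleft : D.extend (D.boxCell (l + 1) m) (l + 1, m + 1) = D.boxCell (l + 1) (m + 1) :=
    D.extend_boxCell hc (by omega) hl (by omega) hl rfl fun i hi => hD.clip_of_type2 h hi
  rw [D.update_of_not_type1 _ (hle.trans_eq (congrArg Cell.value hleft.symm)), hleft]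
  rwa [D.type1_iff_not_type2 (by omega), not_not]

lemma update_boxCell (h₁ : 1 ≤ l) (hl : l + 1 ≤ D.L) :
    D.update (D.boxCell l (m + 1)) (D.boxCell (l + 1) m) l (m + 1) = D.boxCell (l + 1) (m + 1) := by
  by_cases h : D.Type2 (l, m + 1)
  · exact hD.update_of_type2 hc hl h <| hD.value_extend_boxCell_le hc (Or.inl h₁) (by omega)
      (by omega) hl (by omega) (by omega) le_rfl
  · rw [← D.type1_iff_not_type2 (by omega)] at h
    have habove : D.extend (D.boxCell l (m + 1)) (l + 1, m + 1) = D.boxCell (l + 1) (m + 1) :=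
      D.extend_boxCell hc (Or.inl h₁) (by omega) (by omega) hl (by omega)
        fun i hi => hD.clip_of_type1 (by omega) h hi
    rw [D.update_of_type1 h, habove]
    rw [habove]
    exact hD.value_extend_boxCell_le hc (by omega) hl (by omega) hl rfl le_rfl (by omega)

lemma table_eq_boxCell (h₁ : 1 ≤ l) (hL : l ≤ D.L) : D.table m l = D.boxCell l m := by
  induction m generalizing l with
  | zero => exact D.firstColumn_eq_boxCell hc hL
  | succ m ih =>
    induction l, h₁ using Nat.le_induction with
    | base =>
      change D.update ⟨[(0, m + 1)], 0⟩ (D.table m 1) 0 (m + 1) = _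
      rw [ih le_rfl hL]
      refine hD.update_of_type2 hc hL ?_ (D.value_extend_singleton_le hc m)
      exact hD.type2_iff.2 (D.one_le_busy (by omega))
    | succ l h₁ ihl =>
      change D.update (D.table (m + 1) l) (D.table m (l + 1)) l (m + 1) = _
      rw [ihl (by omega), ih (by omega) hL, hD.update_boxCell hc h₁ hL]

lemma outputPath_eq (M : ℕ) : D.outputPath M = D.boxPath D.L M :=
  congrArg Cell.path (hD.table_eq_boxCell hc D.one_le_L le_rfl)

end MonotoneTypes

/-! ### Balance between levels -/

section Balance

variable (q : Policy)

lemma level_of_transRate_ne_zero {q : Policy} {s t : State} (h : D.transRate q s t ≠ 0) :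
    s.1 + s.2 + 1 = t.1 + t.2 ∨ s.1 + s.2 = t.1 + t.2 + 1 := by
  have hup := settle_level q.dispatch s.1 (s.2 + 1)
  have hdown := settle_level q.dispatch (s.1 - 1) s.2
  unfold transRate at h
  by_cases hjoin : settle q.dispatch s.1 (s.2 + 1) = t
  · rw [hjoin] at hup
    omega
  · rw [if_neg hjoin, zero_add] at h
    obtain ⟨hleave, hrate⟩ := ite_ne_right_iff.1 h
    have hbusy : s.1 ≠ 0 := fun h₀ => hrate (by simp [serviceRate, h₀])
    rw [hleave] at hdown
    omega

lemma sum_level_transRate (s : State) (n : ℕ) :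
    ∑ t ∈ level n, D.transRate q s t =
      (if s.1 + s.2 + 1 = n then q.rate s else 0) +
        if s.1 + s.2 = n + 1 then D.serviceRate s else 0 := by
  simp only [transRate, Finset.sum_add_distrib, Finset.sum_ite_eq, mem_level, settle_level]
  congr 1
  rcases Nat.eq_zero_or_pos s.1 with h₀ | h₀
  · simp [serviceRate, h₀]
  · congr 1
    simp only [eq_iff_iff]
    omega

lemma sum_level_transRate_of_mem {s : State} {n : ℕ} (hs : s ∈ level n) :
    ∑ t ∈ level (n + 1), D.transRate q s t = q.rate s := by
  rw [mem_level] at hs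
  rw [sum_level_transRate, if_pos (by omega), if_neg (by omega), add_zero]

lemma sum_level_transRate_of_mem_succ {s : State} {n : ℕ} (hs : s ∈ level (n + 1)) :
    ∑ t ∈ level n, D.transRate q s t = D.serviceRate s := by
  rw [mem_level] at hs
  rw [sum_level_transRate, if_neg (by omega), if_pos hs, zero_add]

lemma tsum_transRate_level_zero (π : State → ℝ) {t : State} (ht : t ∈ level 0) :
    ∑' s, π s * D.transRate q s t = ∑ s ∈ level 1, π s * D.transRate q s t := by
  refine tsum_eq_sum fun s hs => ?_
  by_contra h
  rw [mem_level] at ht hs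
  rcases D.level_of_transRate_ne_zero (right_ne_zero_of_mul h) with h | h <;> omega

lemma tsum_transRate_level_succ (π : State → ℝ) {t : State} {n : ℕ} (ht : t ∈ level (n + 1)) :
    ∑' s, π s * D.transRate q s t =
      ∑ s ∈ level n, π s * D.transRate q s t + ∑ s ∈ level (n + 2), π s * D.transRate q s t := by
  rw [mem_level] at ht
  rw [← Finset.sum_union]
  · refine tsum_eq_sum fun s hs => ?_
    by_contra h
    simp only [Finset.mem_union, mem_level] at hs
    rcases D.level_of_transRate_ne_zero (right_ne_zero_of_mul h) with h | h <;> omega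
  · rw [Finset.disjoint_left]
    intro s hs hs'
    rw [mem_level] at hs hs'
    omega

namespace IsStationary

variable {D q} {π : State → ℝ} (hπ : D.IsStationary q π)
include hπ

lemma sum_level_balance (n : ℕ) :
    ∑ s ∈ level n, π s * q.rate s + ∑ s ∈ level n, π s * D.serviceRate s =
      ∑ t ∈ level n, ∑' s, π s * D.transRate q s t := by
  rw [← Finset.sum_add_distrib]
  exact Finset.sum_congr rfl fun t _ => by rw [← hπ.balance, mul_add]

lemma cut_balance (n : ℕ) :
    ∑ s ∈ level n, π s * q.rate s = ∑ s ∈ level (n + 1), π s * D.serviceRate s := by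
  have hdown (n : ℕ) : ∑ t ∈ level n, ∑ s ∈ level (n + 1), π s * D.transRate q s t =
      ∑ s ∈ level (n + 1), π s * D.serviceRate s := by
    rw [Finset.sum_comm]
    refine Finset.sum_congr rfl fun s hs => ?_
    rw [← Finset.mul_sum, D.sum_level_transRate_of_mem_succ q hs]
  have hup (n : ℕ) : ∑ t ∈ level (n + 1), ∑ s ∈ level n, π s * D.transRate q s t =
      ∑ s ∈ level n, π s * q.rate s := by
    rw [Finset.sum_comm]
    refine Finset.sum_congr rfl fun s hs => ?_
    rw [← Finset.mul_sum, D.sum_level_transRate_of_mem q hs]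
  induction n with
  | zero =>
    have hbal := hπ.sum_level_balance 0
    rwa [Finset.sum_congr rfl fun t ht => D.tsum_transRate_level_zero q π ht, hdown,
      level_zero, Finset.sum_singleton (fun s => π s * D.serviceRate s), serviceRate_zero,
      mul_zero, add_zero, ← level_zero] at hbal
  | succ n ih =>
    have hbal := hπ.sum_level_balance (n + 1)
    rw [Finset.sum_congr rfl fun t ht => D.tsum_transRate_level_succ q π ht,
      Finset.sum_add_distrib, hup, hdown] at hbal
    linarith

lemma summable_mul {f : State → ℝ} {B : ℝ} (hf : ∀ l ≤ D.L, ∀ m, f (l, m) ∈ Icc 0 B) :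
    Summable fun s => π s * f s := by
  refine Summable.of_norm_bounded (hπ.hasSum_one.summable.mul_right B) fun s => ?_
  by_cases hs : s.1 ≤ D.L
  · obtain ⟨h₀, hB⟩ := hf s.1 hs s.2
    rw [Real.norm_of_nonneg (mul_nonneg (hπ.nonneg s) h₀)]
    exact mul_le_mul_of_nonneg_left hB (hπ.nonneg s)
  · simp [hπ.support_states s (not_le.1 hs)]

/-- By cut balance, the terms cancel between adjacent levels. -/
lemma hasSum_level_increments (hq : D.Admissible q) {δ : ℕ → ℝ} {B : ℝ}
    (hδ : ∀ n, δ n ∈ Icc 0 B) :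
    HasSum (fun s => π s * (D.serviceRate s * δ (s.1 + s.2)) -
      π s * (q.rate s * δ (s.1 + s.2 + 1))) 0 := by
  have hservice : Summable fun s => π s * (D.serviceRate s * δ (s.1 + s.2)) :=
    hπ.summable_mul (B := D.L * D.muBar * B) fun l hl m =>
      have hr := D.serviceRate_nonneg m hl
      have hr' := D.serviceRate_le m hl
      ⟨mul_nonneg hr (hδ _).1, mul_le_mul hr' (hδ _).2 (hδ _).1 (hr.trans hr')⟩
  have hrate : Summable fun s => π s * (q.rate s * δ (s.1 + s.2 + 1)) :=
    hπ.summable_mul (B := D.Lam * B) fun l hl m =>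
      have ha := hq.rate_mem l hl m
      ⟨mul_nonneg ha.1 (hδ _).1, mul_le_mul ha.2 (hδ _).2 (hδ _).1 D.Lam_pos.le⟩
  have hlevels (n : ℕ) : ∑ s ∈ level n, π s * (q.rate s * δ (s.1 + s.2 + 1)) =
      ∑ s ∈ level (n + 1), π s * (D.serviceRate s * δ (s.1 + s.2)) := by
    have hcut := congrArg (· * δ (n + 1)) (hπ.cut_balance n)
    simp only [Finset.sum_mul] at hcut
    refine (Finset.sum_congr rfl fun s hs => ?_).trans
      (hcut.trans (Finset.sum_congr rfl fun s hs => ?_)) <;> rw [mem_level.1 hs] <;> ring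
  have hservice' := (hasSum_nat_add_iff' 1).2 (hasSum_sum_level hservice.hasSum)
  rw [Finset.sum_range_one, level_zero, Finset.sum_singleton, serviceRate_zero, zero_mul,
    mul_zero, sub_zero] at hservice'
  have hrate' := hasSum_sum_level hrate.hasSum
  simp only [hlevels] at hrate'
  have h := hservice.hasSum.sub hrate.hasSum
  rwa [hservice'.unique hrate', sub_self] at h

lemma objective_le (hq : D.Admissible q) {v V B : ℝ} (hv : D.HasObjective q π v) {δ : ℕ → ℝ}
    (hδ : ∀ n, δ n ∈ Icc 0 B)
    (hV : ∀ s : State, π s ≠ 0 → D.reward (q.rate s) s - q.rate s * δ (s.1 + s.2 + 1) +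
      D.serviceRate s * δ (s.1 + s.2) ≤ V) : v ≤ V := by
  have hsum := HasSum.add hv (hπ.hasSum_level_increments hq hδ)
  have hsumV := hπ.hasSum_one.mul_right V
  rw [add_zero] at hsum
  rw [one_mul] at hsumV
  refine hasSum_le (fun s => ?_) hsum hsumV
  by_cases hs : π s = 0
  · simp [hs]
  · linarith [mul_le_mul_of_nonneg_left (hV s hs) (hπ.nonneg s)]

end IsStationary

end Balance

/-! ### Stationary regimes on a path -/

/-- Under `q` the system never leaves the states `p 0, …, p n`, where it moves as a birth-death
chain. No other state of level at most `n` accepts riders, and, as a queue with all drivers idle is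
never held, trips are completed until the path is reached. -/
structure FollowsPath (q : Policy) (p : ℕ → State) (n : ℕ) : Prop where
  level_eq : ∀ i ≤ n, (p i).1 + (p i).2 = i
  fst_le : ∀ i ≤ n, (p i).1 ≤ D.L
  hold : ∀ i ≤ n, q.dispatch (p i) = false
  settle_join : ∀ i < n, settle q.dispatch (p i).1 ((p i).2 + 1) = p (i + 1)
  settle_leave : ∀ i < n, settle q.dispatch ((p (i + 1)).1 - 1) (p (i + 1)).2 = p i
  rate_nonneg : ∀ i < n, 0 ≤ q.rate (p i)
  rate_eq_zero : ∀ s : State, s.1 + s.2 ≤ n → s ∉ p '' Iio n → q.rate s = 0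
  dispatch_idle : ∀ m, q.dispatch (0, m + 1) = true

open Classical in
/-- The stationary distribution of the birth-death chain on the path `p 0, …, p n`. -/
def pathLaw (q : Policy) (p : ℕ → State) (n : ℕ) (s : State) : ℝ :=
  if s ∈ p '' Iic n then
    chainWeight (D.serviceRate ∘ p) (q.rate ∘ p) (s.1 + s.2) /
      ∑ i ∈ Finset.range (n + 1), chainWeight (D.serviceRate ∘ p) (q.rate ∘ p) i
  else 0

namespace FollowsPath

variable {D} {q : Policy} {p : ℕ → State} {n i : ℕ} {π : State → ℝ} (h : D.FollowsPath q p n)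
include h

lemma injOn : InjOn p (Iic n) := fun i hi j hj hij => by
  rw [← h.level_eq i hi, hij, h.level_eq j hj]

lemma zero : p 0 = (0, 0) := by
  have := h.level_eq 0 n.zero_le
  exact Prod.ext (by omega) (by omega)

lemma rate_last : q.rate (p n) = 0 := by
  refine h.rate_eq_zero _ (h.level_eq n le_rfl).le ?_
  rintro ⟨i, hi : i < n, heq⟩
  exact hi.ne (h.injOn hi.le (mem_Iic.2 le_rfl) heq)

lemma rate_off {s : State} (hs : s.1 + s.2 ≤ n) (hoff : s ∉ p '' Iic n) : q.rate s = 0 :=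
  h.rate_eq_zero s hs fun hmem => hoff (image_mono Iio_subset_Iic_self hmem)

lemma serviceRate_pos {s : State} (hs : s ≠ (0, 0)) (hL : s.1 ≤ D.L)
    (hhold : q.dispatch s = false) : 0 < D.serviceRate s := by
  obtain ⟨_ | l, m⟩ := s
  · obtain ⟨k, rfl⟩ := Nat.exists_eq_succ_of_ne_zero fun hm : m = 0 => hs (by rw [hm])
    rw [h.dispatch_idle] at hhold
    contradiction
  · exact D.serviceRate_pos m l.succ_pos hL

lemma pathService_pos (hi : i < n) : 0 < (D.serviceRate ∘ p) (i + 1) := by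
  refine h.serviceRate_pos (fun h₀ => ?_) (h.fst_le _ hi) (h.hold _ hi)
  have hlevel := h.level_eq _ hi
  rw [h₀] at hlevel
  contradiction

lemma sum_chainWeight_pos :
    0 < ∑ i ∈ Finset.range (n + 1), chainWeight (D.serviceRate ∘ p) (q.rate ∘ p) i :=
  SpatialQueue.sum_chainWeight_pos (fun _ => h.pathService_pos) h.rate_nonneg

lemma hasSum_of_support (hπ : ∀ s ∉ p '' Iic n, π s = 0) (f : State → ℝ) :
    HasSum (fun s => π s * f s) (∑ i ∈ Finset.range (n + 1), π (p i) * f (p i)) := by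
  classical
  have hrange : (Finset.range (n + 1) : Set ℕ) = Iic n := by
    ext i
    simp
  rw [← Finset.sum_image (f := fun s => π s * f s) (hrange ▸ h.injOn)]
  refine hasSum_sum_of_ne_finset_zero fun s hs => ?_
  rw [hπ s fun hmem => hs (by rwa [← Finset.mem_coe, Finset.coe_image, hrange]), zero_mul]

lemma pathLaw_apply (hi : i ≤ n) :
    D.pathLaw q p n (p i) = chainWeight (D.serviceRate ∘ p) (q.rate ∘ p) i /
      ∑ i ∈ Finset.range (n + 1), chainWeight (D.serviceRate ∘ p) (q.rate ∘ p) i := by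
  rw [pathLaw, if_pos (mem_image_of_mem p (mem_Iic.2 hi)), h.level_eq i hi]

lemma pathLaw_detailed_balance (hi : i < n) :
    D.pathLaw q p n (p (i + 1)) * D.serviceRate (p (i + 1)) =
      D.pathLaw q p n (p i) * q.rate (p i) := by
  have := chainWeight_succ (x := q.rate ∘ p) (h.pathService_pos hi).ne'
  rw [h.pathLaw_apply hi, h.pathLaw_apply hi.le, div_mul_eq_mul_div, div_mul_eq_mul_div]
  exact congrArg (· / _) this

open Classical in
lemma sum_mul_transRate (hbal : ∀ i < n, π (p (i + 1)) * D.serviceRate (p (i + 1)) =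
      π (p i) * q.rate (p i)) (t : State) :
    ∑ i ∈ Finset.range (n + 1), π (p i) * D.transRate q (p i) t =
      ∑ i ∈ Finset.range (n + 1),
        π (p i) * if p i = t then q.rate (p i) + D.serviceRate (p i) else 0 := by
  have hsplit (i : ℕ) : (π (p i) * if p i = t then q.rate (p i) + D.serviceRate (p i) else 0) =
      (if p i = t then π (p i) * D.serviceRate (p i) else 0) +
        if p i = t then π (p i) * q.rate (p i) else 0 := by
    split_ifs <;> ring
  have hzero : D.serviceRate (p 0) = 0 := by rw [h.zero, serviceRate_zero]
  simp only [transRate, mul_add, mul_ite, mul_zero, Finset.sum_add_distrib, hsplit]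
  congr 1
  · rw [Finset.sum_range_succ, Finset.sum_range_succ', h.rate_last, hzero]
    simp only [mul_zero, ite_self, add_zero]
    refine Finset.sum_congr rfl fun i hi => ?_
    rw [Finset.mem_range] at hi
    rw [h.settle_join i hi, hbal i hi]
  · rw [Finset.sum_range_succ', Finset.sum_range_succ _ n, h.rate_last, hzero]
    simp only [mul_zero, ite_self, add_zero]
    refine Finset.sum_congr rfl fun i hi => ?_
    rw [Finset.mem_range] at hi
    rw [h.settle_leave i hi, hbal i hi]

lemma isStationary_pathLaw : D.IsStationary q (D.pathLaw q p n) := by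
  classical
  have hsupp : ∀ s ∉ p '' Iic n, D.pathLaw q p n s = 0 := fun s hs => if_neg hs
  have hW := h.sum_chainWeight_pos
  refine ⟨fun s => ?_, ?_, fun s hs => hsupp s ?_, fun s hs => hsupp s ?_, fun t => ?_⟩
  · by_cases hs : s ∈ p '' Iic n
    · obtain ⟨i, hi : i ≤ n, rfl⟩ := hs
      rw [h.pathLaw_apply hi]
      exact div_nonneg (chainWeight_nonneg (fun j hj => h.pathService_pos (hj.trans_le hi))
        fun j hj => h.rate_nonneg j (hj.trans_le hi)) hW.le
    · rw [hsupp s hs]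
  · have hsum := h.hasSum_of_support hsupp fun _ => 1
    simp only [mul_one] at hsum
    rwa [Finset.sum_congr rfl fun i hi =>
        h.pathLaw_apply (Nat.lt_succ_iff.1 (Finset.mem_range.1 hi)), ← Finset.sum_div,
      div_self hW.ne'] at hsum
  · rintro ⟨i, hi, rfl⟩
    exact (h.fst_le i hi).not_gt hs
  · rintro ⟨i, hi, rfl⟩
    exact Bool.false_ne_true ((h.hold i hi).symm.trans hs)
  · have hout := h.hasSum_of_support hsupp fun s => if s = t then q.rate s + D.serviceRate s else 0
    rw [← h.sum_mul_transRate (fun _ => h.pathLaw_detailed_balance) t] at hout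
    rw [(h.hasSum_of_support hsupp fun s => D.transRate q s t).tsum_eq, ← hout.tsum_eq,
      tsum_eq_single t fun s hs => by rw [if_neg hs, mul_zero], if_pos rfl]

lemma hasObjective_pathLaw (hc : D.cd = D.cr) : D.HasObjective q (D.pathLaw q p n)
    (chainValue D.revenue D.cr (D.serviceRate ∘ p) (q.rate ∘ p) n) := by
  have hsum := h.hasSum_of_support (π := D.pathLaw q p n) (fun s hs => if_neg hs)
    fun s => D.reward (q.rate s) s
  unfold HasObjective
  convert hsum using 1
  rw [chainValue, Finset.centerMass, Finset.smul_sum]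
  refine Finset.sum_congr rfl fun i hi => ?_
  rw [Finset.mem_range, Nat.lt_succ_iff] at hi
  rw [h.pathLaw_apply hi, D.reward_eq hc, h.level_eq i hi, smul_eq_mul, smul_eq_mul,
    Function.comp_apply]
  ring

lemma mem_path_of_transRate_ne_zero (hi : i ≤ n) {t : State} (ht : D.transRate q (p i) t ≠ 0) :
    t ∈ p '' Iic n := by
  contrapose! ht
  have hjoin : settle q.dispatch (p i).1 ((p i).2 + 1) = t → q.rate (p i) = 0 := fun heq => by
    rcases hi.eq_or_lt with rfl | hlt
    · exact h.rate_last
    · exact absurd ⟨i + 1, hlt, (h.settle_join i hlt).symm.trans heq⟩ ht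
  have hleave : settle q.dispatch ((p i).1 - 1) (p i).2 = t → D.serviceRate (p i) = 0 :=
    fun heq => by
      cases i with
      | zero => rw [h.zero, serviceRate_zero]
      | succ i => exact absurd ⟨i, Nat.le_of_succ_le hi, (h.settle_leave i hi).symm.trans heq⟩ ht
  rw [transRate, ite_eq_right_iff.2 hjoin, ite_eq_right_iff.2 hleave, add_zero]

section Uniqueness

variable (hπ : D.IsStationary q π)
include hπ

lemma eq_zero_of_mul_serviceRate_eq_zero {s : State} (hs : s ≠ (0, 0))
    (h₀ : π s * D.serviceRate s = 0) : π s = 0 := by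
  by_cases hL : s.1 ≤ D.L
  · cases hdisp : q.dispatch s
    · exact (mul_eq_zero.1 h₀).resolve_right (h.serviceRate_pos hs hL hdisp).ne'
    · exact hπ.support_hold s hdisp
  · exact hπ.support_states s (not_le.1 hL)

lemma eq_zero_of_flow_eq_zero (h₀ : ∑ s ∈ level i, π s * q.rate s = 0) :
    ∀ s ∈ level (i + 1), π s = 0 := by
  intro s hs
  rw [hπ.cut_balance, Finset.sum_eq_zero_iff_of_nonneg] at h₀
  · refine h.eq_zero_of_mul_serviceRate_eq_zero hπ ?_ (h₀ s hs)
    rintro rfl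
    exact i.succ_ne_zero (mem_level.1 hs).symm
  · intro t _
    by_cases hL : t.1 ≤ D.L
    · exact mul_nonneg (hπ.nonneg t) (D.serviceRate_nonneg _ hL)
    · rw [hπ.support_states t (not_le.1 hL), zero_mul]

lemma eq_zero_above {s : State} (hs : n < s.1 + s.2) : π s = 0 := by
  suffices ∀ i, n + 1 ≤ i → ∀ s ∈ level i, π s = 0 from this _ hs s (mem_level.2 rfl)
  intro i hi
  induction i, hi using Nat.le_induction with
  | base =>
    refine h.eq_zero_of_flow_eq_zero hπ (Finset.sum_eq_zero fun s hs => ?_)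
    have hrate : q.rate s = 0 := by
      by_cases hmem : s ∈ p '' Iic n
      · obtain ⟨j, hj, rfl⟩ := hmem
        rw [mem_level, h.level_eq j hj] at hs
        rw [hs, h.rate_last]
      · exact h.rate_off (mem_level.1 hs).le hmem
    rw [hrate, mul_zero]
  | succ i _ ih =>
    exact h.eq_zero_of_flow_eq_zero hπ (Finset.sum_eq_zero fun s hs => by rw [ih s hs, zero_mul])

/-- By downward induction on the level: a state off the path is entered neither from the path nor,
below level `n`, by a rider who joins off the path. -/
lemma eq_zero_off {s : State} (hs : s ∉ p '' Iic n) : π s = 0 := by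
  suffices ∀ k, ∀ t : State, n < t.1 + t.2 + k → t ∉ p '' Iic n → π t = 0 from
    this (n + 1) s (by omega) hs
  intro k
  induction k with
  | zero => exact fun t ht _ => h.eq_zero_above hπ ht
  | succ k ih =>
    intro t ht hoff
    by_cases htn : n < t.1 + t.2
    · exact h.eq_zero_above hπ htn
    refine h.eq_zero_of_mul_serviceRate_eq_zero hπ
      (fun h₀ => hoff ⟨0, n.zero_le, by rw [h.zero, h₀]⟩) ?_
    have hbal := hπ.balance t
    rw [h.rate_off (not_lt.1 htn) hoff, zero_add] at hbal
    rw [hbal]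
    refine (tsum_congr fun s => ?_).trans tsum_zero
    by_contra hne
    have htrans := right_ne_zero_of_mul hne
    by_cases hmem : s ∈ p '' Iic n
    · obtain ⟨i, hi, rfl⟩ := hmem
      exact hoff (h.mem_path_of_transRate_ne_zero hi htrans)
    · have hsk : s.1 + s.2 + k ≤ n := not_lt.1 fun hlt => hne (by rw [ih s hlt hmem, zero_mul])
      rcases D.level_of_transRate_ne_zero htrans with hlevel | hlevel
      · have hsettle : settle q.dispatch (s.1 - 1) s.2 ≠ t := fun heq => by
          have := settle_level q.dispatch (s.1 - 1) s.2
          rw [heq] at this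
          omega
        rw [transRate, h.rate_off (by omega) hmem, ite_self, if_neg hsettle, add_zero] at htrans
        exact htrans rfl
      · omega

lemma eq_pathLaw : π = D.pathLaw q p n := by
  have hsupp : ∀ s ∉ p '' Iic n, π s = 0 := fun s => h.eq_zero_off hπ
  have hlevel (f : State → ℝ) {i : ℕ} (hi : i ≤ n) :
      ∑ s ∈ level i, π s * f s = π (p i) * f (p i) := by
    refine Finset.sum_eq_single_of_mem _ (mem_level.2 (h.level_eq i hi)) fun s hs hne => ?_
    rw [hsupp s, zero_mul]
    rintro ⟨j, hj, rfl⟩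
    rw [mem_level, h.level_eq j hj] at hs
    exact hne (by rw [hs])
  have hbal (i : ℕ) (hi : i < n) : π (p (i + 1)) * D.serviceRate (p (i + 1)) =
      π (p i) * q.rate (p i) := by
    rw [← hlevel _ hi.le, ← hlevel _ hi, hπ.cut_balance]
  have hone : ∑ i ∈ Finset.range (n + 1), π (p i) = 1 := by
    have hsum := h.hasSum_of_support hsupp fun _ => 1
    simp only [mul_one] at hsum
    exact hsum.unique hπ.hasSum_one
  funext s
  by_cases hs : s ∈ p '' Iic n
  · obtain ⟨i, hi, rfl⟩ := hs
    rw [h.pathLaw_apply hi]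
    exact eq_chainWeight_div_sum (fun _ => h.pathService_pos) hbal hone hi
  · rw [hsupp s hs, pathLaw, if_neg hs]

end Uniqueness

lemma isOptimalAmong (hc : D.cd = D.cr) (hq : D.Admissible q) {A : (State → ℝ) → Prop}
    (hA : A (D.pathLaw q p n)) (hmax : ∀ q' π' v', D.Admissible q' → D.IsStationary q' π' → A π' →
      D.HasObjective q' π' v' → v' ≤ chainValue D.revenue D.cr (D.serviceRate ∘ p) (q.rate ∘ p) n) :
    D.IsOptimalAmong A q :=
  ⟨hq, _, _, h.isStationary_pathLaw, fun _ => h.eq_pathLaw, hA, h.hasObjective_pathLaw hc, hmax⟩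

end FollowsPath

/-! ### Dispatching along the clipped zigzag path -/

lemma mem_boxPath_L {M l m : ℕ} : (l, m) ∈ D.boxPath D.L M ↔
    l + m ≤ D.L + M ∧ m ≤ M ∧ l = max (l + m - M) (D.busy (l + m)) := by
  have := D.busy_le_L (l + m)
  rw [mem_boxPath]
  simp only [clip, clipBusy, Prod.mk.injEq]
  omega

lemma pathDispatch_boxPath_right {M l : ℕ} (hl : l < D.L) (h : (l, M) ∈ D.boxPath D.L M) :
    D.pathDispatch (D.boxPath D.L M) (l, M + 1) = true := by
  simp only [pathDispatch, decide_eq_true_eq]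
  exact ⟨hl, ⟨M, h⟩, fun m hm => Nat.lt_succ_of_le (D.mem_boxPath_L.1 hm).2.1⟩

lemma pathDispatch_boxPath_idle (M m : ℕ) :
    D.pathDispatch (D.boxPath D.L M) (0, m + 1) = true := by
  simp only [pathDispatch, decide_eq_true_eq]
  refine ⟨D.one_le_L, ⟨0, ?_⟩, fun k hk => Nat.lt_succ_of_le (le_trans ?_ m.zero_le)⟩
  · simp [mem_boxPath_L, busy_zero]
  · by_contra! hpos
    have := D.one_le_busy (n := 0 + k) (by omega)
    rw [mem_boxPath_L] at hk
    omega

lemma typeRule_idle (m : ℕ) : D.typeRule (0, m + 1) = true := by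
  rw [typeRule_eq_true]
  refine ⟨D.one_le_L, m.succ_ne_zero, ?_⟩
  rw [serviceRate_zero]
  exact D.serviceRate_nonneg _ D.one_le_L

namespace MonotoneTypes

variable {D} (hD : D.MonotoneTypes) {l m M i n : ℕ}
include hD

lemma typeRule_eq_false : D.typeRule (l, m) = false ↔ D.busy (l + m) ≤ l := by
  rw [← Bool.not_eq_true, D.typeRule_eq_true, hD.type2_iff, not_lt]

lemma pathDispatch_eq (hm : m ≤ M) :
    D.pathDispatch (D.boxPath D.L M) (l, m) = D.typeRule (l, m) := by
  classical
  rw [Bool.eq_iff_iff, typeRule_eq_true, hD.type2_iff]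
  simp only [pathDispatch, decide_eq_true_eq, mem_boxPath_L]
  have hL := D.busy_le_L (l + m)
  constructor
  · rintro ⟨hl, ⟨k, hk⟩, hright⟩
    by_contra! hle
    have hkm := hright k hk
    have hmono := D.monotone_busy (show l + k ≤ l + m by omega)
    exact lt_irrefl m (hright m ⟨by omega, hm, by omega⟩)
  · intro hlt
    obtain ⟨j, hj, hbusy⟩ := D.exists_busy_eq hlt
    refine ⟨by omega, ⟨j, by omega, by omega, by omega⟩, fun k hk => ?_⟩
    by_contra! hle
    have hmono := D.monotone_busy (show l + m ≤ l + k by omega)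
    omega

section Settle

variable {φ : State → Bool} (hφ : ∀ l ≤ D.L, ∀ m ≤ M, φ (l, m) = D.typeRule (l, m))
include hφ

lemma dispatch_clip (hi : i ≤ D.L + M) : φ (D.clip D.L M i) = false := by
  have hL := D.busy_le_L i
  refine (hφ _ (D.clip_fst_le hi) _ (D.clip_snd_le ..)).trans (hD.typeRule_eq_false.2 ?_)
  rw [D.clip_level]
  simp only [clip, clipBusy]
  omega

lemma settle_eq_clip (hi : i ≤ D.L + M) (hlevel : l + m = i) (hm : m ≤ M)
    (hle : l ≤ D.clipBusy D.L M i) : settle φ l m = D.clip D.L M i := by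
  induction m generalizing l with
  | zero =>
    have := D.clipBusy_le D.L M i
    exact (D.clip_eq_mk (by omega) hlevel).symm
  | succ m ih =>
    have hclip : D.clipBusy D.L M i = max (i - M) (D.busy i) := by
      rw [clipBusy, min_eq_right (D.busy_le_L i)]
    rw [settle, hφ l (hle.trans (D.clip_fst_le hi)) _ hm]
    split_ifs with htype
    · rw [typeRule_eq_true, hD.type2_iff, hlevel] at htype
      exact ih (by omega) (by omega) (by omega)
    · rw [Bool.not_eq_true, hD.typeRule_eq_false, hlevel] at htype
      exact (D.clip_eq_mk (by omega) hlevel).symm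

lemma settle_clip_join (hi : i < D.L + M)
    (hM : (D.clip D.L M i).2 = M → φ ((D.clip D.L M i).1, M + 1) = true) :
    settle φ (D.clip D.L M i).1 ((D.clip D.L M i).2 + 1) = D.clip D.L M (i + 1) := by
  have hlevel := D.clip_level D.L M i
  rcases (D.clip_snd_le D.L M i).eq_or_lt with hsnd | hsnd
  · rw [hsnd, settle, if_pos (hM hsnd)]
    exact hD.settle_eq_clip hφ hi (by omega) le_rfl (le_max_of_le_left (by omega))
  · refine hD.settle_eq_clip hφ hi (by omega) hsnd ?_
    exact max_le_max (by omega) (min_le_min_left _ (D.monotone_busy i.le_succ))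

lemma settle_clip_leave (hi : i < D.L + M) :
    settle φ ((D.clip D.L M (i + 1)).1 - 1) (D.clip D.L M (i + 1)).2 = D.clip D.L M i := by
  have hlevel := D.clip_level D.L M (i + 1)
  have hone : 1 ≤ (D.clip D.L M (i + 1)).1 := D.one_le_clip_fst D.one_le_L (Nat.succ_pos i)
  have hstep := D.busy_succ_le i
  refine hD.settle_eq_clip hφ hi.le (by omega) (D.clip_snd_le ..) ?_
  simp only [clip, clipBusy]
  omega

end Settle

end MonotoneTypes

/-! ### Shadow prices -/

/-- The optimality inequality of the average-reward problem with value `V`, on the states in `S`;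
`δ n` is the price of raising the number of riders in the system from `n - 1` to `n`. -/
structure IsShadowPrice (S : Set State) (V : ℝ) (δ : ℕ → ℝ) : Prop where
  mem : ∀ n, δ n ∈ Icc 0 D.fareMax
  le : ∀ s ∈ S, ∀ a ∈ Icc 0 D.Lam,
    D.reward a s - a * δ (s.1 + s.2 + 1) + D.serviceRate s * δ (s.1 + s.2) ≤ V

namespace IsShadowPrice

variable {D} {S : Set State} {V : ℝ} {δ : ℕ → ℝ}

lemma objective_le (h : D.IsShadowPrice S V δ) {q : Policy} {π : State → ℝ} {v : ℝ}
    (hq : D.Admissible q) (hπ : D.IsStationary q π) (hS : ∀ s, π s ≠ 0 → s ∈ S)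
    (hv : D.HasObjective q π v) : v ≤ V := by
  refine hπ.objective_le hq hv h.mem fun s hs => h.le s (hS s hs) _ ?_
  exact hq.rate_mem s.1 (not_lt.1 fun hL => hs (hπ.support_states s hL)) s.2

lemma extend {M : ℕ} (hc : D.cd = D.cr) (hM : D.L * D.muBar * D.fareMax ≤ D.cr * M) (hV : 0 ≤ V)
    (h : D.IsShadowPrice (Iic (D.L, M)) V δ) :
    D.IsShadowPrice {s | s.1 ≤ D.L} V fun n => if n < M then δ n else D.fareMax where
  mem n := by
    split_ifs
    exacts [h.mem n, ⟨D.fareMax_pos.le, le_rfl⟩]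
  le s hs a ha := by
    have hreject : D.reward a s - a * D.fareMax ≤ D.reward 0 s := by
      rw [D.reward_eq hc, D.reward_eq hc, revenue_zero]
      linarith [D.revenue_le_mul_fareMax ha]
    by_cases hlevel : s.1 + s.2 < M
    · have hmem : s ∈ Iic (D.L, M) := ⟨hs, show s.2 ≤ M by omega⟩
      rw [if_pos hlevel]
      split_ifs
      · exact h.le s hmem a ha
      · have hzero := h.le s hmem 0 ⟨le_rfl, D.Lam_pos.le⟩
        rw [zero_mul] at hzero
        linarith
    · have hservice : D.serviceRate s * D.fareMax ≤ D.L * D.muBar * D.fareMax :=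
        mul_le_mul_of_nonneg_right (D.serviceRate_le s.2 hs) D.fareMax_pos.le
      have hqueue : D.cr * M ≤ D.cr * (s.1 + s.2 : ℕ) :=
        mul_le_mul_of_nonneg_left (Nat.cast_le.2 (not_lt.1 hlevel)) D.cr_pos.le
      rw [if_neg hlevel, if_neg (by omega)]
      rw [D.reward_eq hc 0, revenue_zero] at hreject
      linarith

end IsShadowPrice

/-! ### Optimal pricing along the clipped zigzag path -/

section BoxPath

variable {D} {M i : ℕ} {x : State → ℝ}

lemma pathRate_mem (hx : ∀ s, x s ∈ Icc 0 D.Lam) (P : List State) (s : State) :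
    pathRate P x s ∈ Icc 0 D.Lam := by
  unfold pathRate
  split_ifs
  exacts [hx s, ⟨le_rfl, D.Lam_pos.le⟩]

lemma pathRate_clip (hi : i ≤ D.L + M) (x : State → ℝ) :
    pathRate (D.boxPath D.L M) x (D.clip D.L M i) =
      if i < D.L + M then x (D.clip D.L M i) else 0 := by
  have hnth := (D.isLevelPath_boxPath (b := M) (.inl D.one_le_L) le_rfl).pathRate_nth hi x
  rwa [D.nth_boxPath hi] at hnth

lemma serviceRate_clip_pos (hi : i < D.L + M) : 0 < (D.serviceRate ∘ D.clip D.L M) (i + 1) :=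
  D.serviceRate_pos _ (D.one_le_clip_fst D.one_le_L i.succ_pos) (D.clip_fst_le hi)

lemma pathValue_boxPath (hc : D.cd = D.cr) (hx : ∀ s, 0 ≤ x s) : D.pathValue (D.boxPath D.L M) x =
    chainValue D.revenue D.cr (D.serviceRate ∘ D.clip D.L M)
      (pathRate (D.boxPath D.L M) x ∘ D.clip D.L M) (D.L + M) := by
  rw [(D.isLevelPath_boxPath (.inl D.one_le_L) le_rfl).pathValue_eq hc hx, Nat.cast_zero, mul_zero,
    sub_zero]
  exact chainValue_congr (fun i hi => congrArg D.serviceRate (D.nth_boxPath hi))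
    fun i hi => congrArg (pathRate _ x) (D.nth_boxPath hi)

lemma exists_isOptimalPricing (hc : D.cd = D.cr) (M : ℕ) :
    ∃ x, D.IsOptimalPricing (D.boxPath D.L M) x := by
  have hcompact : IsCompact (univ.pi fun _ : State => Icc 0 D.Lam) :=
    isCompact_univ_pi fun _ => isCompact_Icc
  have hrate : Continuous fun x => pathRate (D.boxPath D.L M) x ∘ D.clip D.L M := by
    refine continuous_pi fun i => ?_
    simp only [Function.comp_apply, pathRate]
    split_ifs <;> fun_prop
  have hcont : ContinuousOn (D.pathValue (D.boxPath D.L M)) (univ.pi fun _ => Icc 0 D.Lam) := by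
    have hmaps : MapsTo (fun x => pathRate (D.boxPath D.L M) x ∘ D.clip D.L M)
        (univ.pi fun _ => Icc 0 D.Lam) (univ.pi fun _ => Icc 0 D.Lam) :=
      fun x hx i _ => pathRate_mem (fun s => hx s (mem_univ s)) _ _
    have hvalue := continuousOn_chainValue (c := D.cr)
      (fun i (hi : i < D.L + M) => serviceRate_clip_pos hi) (fun a ha => ha.1)
      D.continuousOn_revenue
    exact (hvalue.comp hrate.continuousOn hmaps).congr fun x hx =>
      pathValue_boxPath hc fun s => (hx s (mem_univ s)).1
  obtain ⟨x, hx, hmax⟩ :=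
    hcompact.exists_isMaxOn ⟨fun _ => 0, fun _ _ => ⟨le_rfl, D.Lam_pos.le⟩⟩ hcont
  exact ⟨x, fun s => hx s (mem_univ s), fun y hy => hmax fun s _ => hy s⟩

namespace IsOptimalPricing

variable (hx : D.IsOptimalPricing (D.boxPath D.L M) x)
include hx

lemma chainValue_le (hc : D.cd = D.cr) {y : ℕ → ℝ} (hy : ∀ i, y i ∈ Icc 0 D.Lam)
    (hlast : y (D.L + M) = 0) :
    chainValue D.revenue D.cr (D.serviceRate ∘ D.clip D.L M) y (D.L + M) ≤
      D.pathValue (D.boxPath D.L M) x := by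
  refine le_trans (le_of_eq ?_) (hx.2 (fun s => y (s.1 + s.2)) fun s => hy _)
  rw [pathValue_boxPath hc fun s => (hy _).1]
  refine chainValue_congr (fun _ _ => rfl) fun i hi => ?_
  rw [Function.comp_apply, pathRate_clip hi, D.clip_level]
  split_ifs with hlt
  · rfl
  · rw [hi.antisymm (not_lt.1 hlt), hlast]

lemma pathValue_nonneg (hc : D.cd = D.cr) : 0 ≤ D.pathValue (D.boxPath D.L M) x := by
  have hzero := hx.chainValue_le hc (y := 0) (fun _ => ⟨le_rfl, D.Lam_pos.le⟩) rfl
  rwa [chainValue_eq_zero D.revenue_zero rfl] at hzero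

lemma exists_isShadowPrice (hD : D.MonotoneTypes) (hc : D.cd = D.cr) :
    ∃ δ, D.IsShadowPrice (Iic (D.L, M)) (D.pathValue (D.boxPath D.L M) x) δ := by
  have hzero : (D.serviceRate ∘ D.clip D.L M) 0 = 0 := by
    rw [Function.comp_apply, clip_zero, serviceRate_zero]
  obtain ⟨δ, hδ, hle⟩ := exists_bellman D.cr_pos.le D.Lam_pos.le D.fareMax_pos.le
    D.continuousOn_revenue D.revenue_zero (fun a ha => D.revenue_le_mul_fareMax ha) hzero
    (fun i => serviceRate_clip_pos) fun y hy hlast => hx.chainValue_le hc hy hlast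
  refine ⟨δ, hδ, fun s ⟨(hl : s.1 ≤ D.L), (hm : s.2 ≤ M)⟩ a ha => ?_⟩
  have hservice : D.serviceRate s * δ (s.1 + s.2) ≤
      D.serviceRate (D.clip D.L M (s.1 + s.2)) * δ (s.1 + s.2) :=
    mul_le_mul_of_nonneg_right (hD.serviceRate_le_clip le_rfl hl hm) (hδ _).1
  have hlevel := hle (s.1 + s.2) (add_le_add hl hm) a ha
  rw [Function.comp_apply] at hlevel
  rw [D.reward_eq hc]
  linarith

/-- Complementary slackness: the value of the path is an average, over its states, of the left-hand
sides of the optimality inequality. -/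
lemma reward_add_eq_pathValue (hc : D.cd = D.cr) {S : Set State} {δ : ℕ → ℝ}
    (hδ : D.IsShadowPrice S (D.pathValue (D.boxPath D.L M) x) δ)
    (hS : ∀ i ≤ D.L + M, D.clip D.L M i ∈ S) (hi : i ≤ D.L + M)
    (hpos : ∀ j < i, 0 < pathRate (D.boxPath D.L M) x (D.clip D.L M j)) :
    D.reward (pathRate (D.boxPath D.L M) x (D.clip D.L M i)) (D.clip D.L M i) -
      pathRate (D.boxPath D.L M) x (D.clip D.L M i) * δ (i + 1) +
        D.serviceRate (D.clip D.L M i) * δ i = D.pathValue (D.boxPath D.L M) x := by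
  have hrate (i : ℕ) := pathRate_mem hx.1 (D.boxPath D.L M) (D.clip D.L M i)
  have hle (i) (hi : i ≤ D.L + M) := hδ.le _ (hS i hi) _ (hrate i)
  simp only [D.reward_eq hc, D.clip_level] at hle ⊢
  have hslack := sum_chainWeight_mul_slack (g := D.revenue) (c := D.cr)
    (ρ := D.serviceRate ∘ D.clip D.L M) (x := pathRate (D.boxPath D.L M) x ∘ D.clip D.L M)
    (n := D.L + M) (by rw [Function.comp_apply, clip_zero, serviceRate_zero])
    (fun _ => serviceRate_clip_pos) (fun i _ => (hrate i).1)
    ((pathRate_clip le_rfl x).trans (if_neg (lt_irrefl _))) (D.pathValue (D.boxPath D.L M) x) δ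
  rw [← pathValue_boxPath hc fun s => (hx.1 s).1, sub_self, zero_mul,
    Finset.sum_eq_zero_iff_of_nonneg fun i hi => ?_] at hslack
  · have hw : chainWeight (D.serviceRate ∘ D.clip D.L M)
        (pathRate (D.boxPath D.L M) x ∘ D.clip D.L M) i ≠ 0 :=
      (chainWeight_pos (fun j hj => serviceRate_clip_pos (hj.trans_le hi)) hpos).ne'
    have hzero := hslack i (Finset.mem_range.2 (Nat.lt_succ_of_le hi))
    simp only [mul_eq_zero, hw, false_or, Function.comp_apply] at hzero
    linarith
  · rw [Finset.mem_range, Nat.lt_succ_iff] at hi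
    refine mul_nonneg (chainWeight_nonneg (fun j hj => serviceRate_clip_pos (hj.trans_le hi))
      fun j _ => (hrate j).1) ?_
    simp only [Function.comp_apply]
    linarith [hle i hi]

/-- If no state before level `M` rejects riders, then slackness at level `M - 1`, where the shadow
price of a rider is the maximal fare, contradicts that every accepted rider pays less. -/
lemma exists_pathRate_eq_zero (hD : D.MonotoneTypes) (hc : D.cd = D.cr)
    (hM : D.L * D.muBar * D.fareMax ≤ D.cr * M) :
    ∃ i < M, pathRate (D.boxPath D.L M) x (D.clip D.L M i) = 0 := by
  by_contra! hne
  have hrate (i : ℕ) := pathRate_mem hx.1 (D.boxPath D.L M) (D.clip D.L M i)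
  have hpos (i) (hi : i < M) : 0 < pathRate (D.boxPath D.L M) x (D.clip D.L M i) :=
    (hrate i).1.lt_of_ne (hne i hi).symm
  have hMpos : 0 < D.cr * M := by
    refine lt_of_lt_of_le (mul_pos ?_ D.fareMax_pos) hM
    exact (D.serviceRate_pos 0 one_pos D.one_le_L).trans_le (D.serviceRate_le 0 D.one_le_L)
  obtain ⟨k, rfl⟩ : ∃ k, M = k + 1 :=
    Nat.exists_eq_succ_of_ne_zero fun h => by simp [h] at hMpos
  obtain ⟨δ, hδ⟩ := hx.exists_isShadowPrice hD hc
  have hext := hδ.extend hc hM (hx.pathValue_nonneg hc)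
  have hslack := hx.reward_add_eq_pathValue hc hext (fun i hi => D.clip_fst_le hi)
    (i := k) (by omega) fun j hj => hpos j (by omega)
  have hreject := hext.le (D.clip D.L (k + 1) k) (D.clip_fst_le (by omega)) 0
    ⟨le_rfl, D.Lam_pos.le⟩
  have hfare := mul_lt_mul_of_pos_left (D.fare_lt (hrate k) (hpos k k.lt_succ_self))
    (hpos k k.lt_succ_self)
  simp only [D.clip_level, D.reward_eq hc, revenue_zero, lt_irrefl, if_false, zero_mul]
    at hslack hreject
  rw [revenue] at hslack
  linarith

end IsOptimalPricing

end BoxPath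

/-! ### The returned policies -/

variable {D} {M n : ℕ} {x : State → ℝ}

lemma admissible_typePolicy {r : State → ℝ} (hr : ∀ s, r s ∈ Icc 0 D.Lam) :
    D.Admissible ⟨D.typeRule, r⟩ where
  rate_mem l _ m := hr (l, m)
  hold_no_rider _ _ := by simp [typeRule, Type2]
  hold_no_driver _ := by simp [typeRule, Type2]

namespace MonotoneTypes

variable (hD : D.MonotoneTypes)
include hD

lemma admissible_pathPolicy (hx : ∀ s, x s ∈ Icc 0 D.Lam) :
    D.Admissible (D.pathPolicy (D.boxPath D.L M) x) where
  rate_mem l _ m := pathRate_mem hx _ (l, m)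
  hold_no_rider l _ := (hD.pathDispatch_eq M.zero_le).trans (hD.typeRule_eq_false.2 (D.busy_le l))
  hold_no_driver _ := by simp [pathPolicy, pathDispatch]

lemma followsPath_clip {φ : State → Bool}
    (hφ : ∀ l ≤ D.L, ∀ m ≤ M, φ (l, m) = D.typeRule (l, m)) (hidle : ∀ m, φ (0, m + 1) = true)
    (hn : n ≤ D.L + M)
    (hM : ∀ i < n, (D.clip D.L M i).2 = M → φ ((D.clip D.L M i).1, M + 1) = true)
    (hx : ∀ s, x s ∈ Icc 0 D.Lam) (hzero : pathRate (D.boxPath D.L M) x (D.clip D.L M n) = 0) :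
    D.FollowsPath ⟨φ, pathRate (D.boxPath D.L M) x⟩ (D.clip D.L M) n where
  level_eq i _ := D.clip_level D.L M i
  fst_le _ hi := D.clip_fst_le (hi.trans hn)
  hold _ hi := hD.dispatch_clip hφ (hi.trans hn)
  settle_join i hi := hD.settle_clip_join hφ (hi.trans_le hn) (hM i hi)
  settle_leave _ hi := hD.settle_clip_leave hφ (hi.trans_le hn)
  rate_nonneg _ _ := (pathRate_mem hx _ _).1
  rate_eq_zero s hs hoff := by
    by_contra hne
    have hmem : s ∈ D.boxPath D.L M :=
      List.dropLast_subset _ (not_imp_comm.1 (fun h => if_neg h) hne)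
    rw [(D.mem_boxPath.1 hmem).2] at hne hoff
    rcases hs.eq_or_lt with heq | hlt
    · exact hne (heq ▸ hzero)
    · exact hoff (mem_image_of_mem _ hlt)
  dispatch_idle := hidle

lemma followsPath_pathPolicy (hx : ∀ s, x s ∈ Icc 0 D.Lam) :
    D.FollowsPath (D.pathPolicy (D.boxPath D.L M) x) (D.clip D.L M) (D.L + M) := by
  refine hD.followsPath_clip (fun l _ m hm => hD.pathDispatch_eq hm)
    (D.pathDispatch_boxPath_idle M) le_rfl (fun i hi hM => ?_) hx
    ((pathRate_clip le_rfl x).trans (if_neg (lt_irrefl _)))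
  have hlevel := D.clip_level D.L M i
  have hclip : ((D.clip D.L M i).1, M) = D.clip D.L M i := Prod.ext rfl hM.symm
  refine D.pathDispatch_boxPath_right (by omega) ?_
  rw [hclip, mem_boxPath, hlevel]
  exact ⟨hi.le, rfl⟩

lemma followsPath_typePolicy (hx : ∀ s, x s ∈ Icc 0 D.Lam) (hn : n ≤ M)
    (hzero : pathRate (D.boxPath D.L M) x (D.clip D.L M n) = 0) :
    D.FollowsPath ⟨D.typeRule, pathRate (D.boxPath D.L M) x⟩ (D.clip D.L M) n := by
  refine hD.followsPath_clip (fun _ _ _ _ => rfl) D.typeRule_idle (hn.trans (M.le_add_left D.L))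
    (fun i hi hM => ?_) hx hzero
  have hlevel := D.clip_level D.L M i
  omega

end MonotoneTypes

namespace IsOptimalPricing

variable (hx : D.IsOptimalPricing (D.boxPath D.L M) x) (hD : D.MonotoneTypes) (hc : D.cd = D.cr)
include hx hD hc

theorem isOptimalQueueBounded_pathPolicy :
    D.IsOptimalQueueBounded M (D.pathPolicy (D.boxPath D.L M) x) := by
  obtain ⟨δ, hδ⟩ := hx.exists_isShadowPrice hD hc
  refine (hD.followsPath_pathPolicy hx.1).isOptimalAmong hc (hD.admissible_pathPolicy hx.1)
    (fun s hs => if_neg ?_) fun q π v hq hπ hM hv => ?_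
  · rintro ⟨i, -, rfl⟩
    exact hs.not_ge (D.clip_snd_le D.L M i)
  · refine (hδ.objective_le hq hπ (fun s hs => ⟨?_, ?_⟩) hv).trans_eq
      (pathValue_boxPath hc fun s => (hx.1 s).1)
    · exact not_lt.1 fun hlt => hs (hπ.support_states s hlt)
    · exact not_lt.1 fun hlt => hs (hM s hlt)

variable (hM : D.L * D.muBar * D.fareMax ≤ D.cr * M)
include hM

lemma objective_le {q : Policy} {π : State → ℝ} {v : ℝ} (hq : D.Admissible q)
    (hπ : D.IsStationary q π) (hv : D.HasObjective q π v) :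
    v ≤ D.pathValue (D.boxPath D.L M) x := by
  obtain ⟨δ, hδ⟩ := hx.exists_isShadowPrice hD hc
  exact (hδ.extend hc hM (hx.pathValue_nonneg hc)).objective_le hq hπ
    (fun s hs => not_lt.1 fun hlt => hs (hπ.support_states s hlt)) hv

theorem isOptimal_pathPolicy : D.IsOptimal (D.pathPolicy (D.boxPath D.L M) x) :=
  (hD.followsPath_pathPolicy hx.1).isOptimalAmong hc (hD.admissible_pathPolicy hx.1) trivial
    fun _ _ _ hq hπ _ hv => (hx.objective_le hD hc hM hq hπ hv).trans_eq
      (pathValue_boxPath hc fun s => (hx.1 s).1)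

theorem isOptimal_typePolicy :
    D.IsOptimal ⟨D.typeRule, pathRate (D.boxPath D.L M) x⟩ := by
  obtain ⟨n, hn, hzero⟩ := hx.exists_pathRate_eq_zero hD hc hM
  refine (hD.followsPath_typePolicy hx.1 hn.le hzero).isOptimalAmong hc
    (admissible_typePolicy (pathRate_mem hx.1 _)) trivial fun q π v hq hπ _ hv => ?_
  refine (hx.objective_le hD hc hM hq hπ hv).trans_eq ?_
  rw [pathValue_boxPath hc fun s => (hx.1 s).1]
  exact chainValue_eq_of_eq_zero (by omega) hzero

end IsOptimalPricing

end Model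

end SpatialQueue

end

open SpatialQueue SpatialQueue.Model in
theorem theorem2_general (D : Model) (hD : D.MonotoneTypes) (hc : D.cd = D.cr) (M : ℕ) :
    (∀ k, (zigzag D.typeRule k).2 ≤ M →
      (D.outputPath M)[k]? = some (zigzag D.typeRule k)) ∧
    (∀ l ≤ D.L, ∀ m ≤ M,
      (D.Type1 (l, m) → D.pathDispatch (D.outputPath M) (l, m) = false) ∧
      (D.Type2 (l, m) → D.pathDispatch (D.outputPath M) (l, m) = true)) ∧
    (∃ x, D.IsOptimalPricing (D.outputPath M) x) ∧
    ∀ x, D.IsOptimalPricing (D.outputPath M) x →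
      D.IsOptimalQueueBounded M (D.pathPolicy (D.outputPath M) x) ∧
      (D.L * D.muBar * D.fareMax ≤ D.cr * M →
        D.IsOptimal (D.pathPolicy (D.outputPath M) x) ∧
        D.IsOptimal
          { dispatch := D.typeRule, rate := (D.pathPolicy (D.outputPath M) x).rate }) := by
  rw [hD.outputPath_eq hc M]
  refine ⟨fun k hk => ?_, fun l hl m hm => ?_, exists_isOptimalPricing hc M, fun x hx =>
    ⟨hx.isOptimalQueueBounded_pathPolicy hD hc, fun hM =>
      ⟨hx.isOptimal_pathPolicy hD hc hM, hx.isOptimal_typePolicy hD hc hM⟩⟩⟩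
  · have hlevel := zigzag_level D.typeRule k
    have hL : (zigzag D.typeRule k).1 ≤ D.L := D.busy_le_L k
    rw [D.getElem?_boxPath (by omega), D.clip_eq_zigzag hL]
    rwa [zigzag_typeRule] at hk
  · rw [hD.pathDispatch_eq hm]
    exact ⟨fun h => hD.typeRule_eq_false.2 ((hD.type1_iff hl).1 h), D.typeRule_eq_true.2⟩

theorem theorem2 (D : SpatialQueue.Model) (hD : D.DiminishingReturns) (hc : D.cd = D.cr) (M : ℕ) :
    -- the returned path follows the zigzag path of the type rule as long as that path is in the table
    (∀ k, (SpatialQueue.Model.zigzag D.typeRule k).2 ≤ M →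
      (D.outputPath M)[k]? = some (SpatialQueue.Model.zigzag D.typeRule k)) ∧
    -- the returned dispatching policy holds on type 1 states and dispatches on type 2 states
    (∀ l ≤ D.L, ∀ m ≤ M,
      (D.Type1 (l, m) → D.pathDispatch (D.outputPath M) (l, m) = false) ∧
      (D.Type2 (l, m) → D.pathDispatch (D.outputPath M) (l, m) = true)) ∧
    -- there is an optimal pricing along the returned path, and any such pricing makes an optimal policy
    (∃ x, D.IsOptimalPricing (D.outputPath M) x) ∧
    ∀ x, D.IsOptimalPricing (D.outputPath M) x →
      D.IsOptimalQueueBounded M (D.pathPolicy (D.outputPath M) x) ∧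
      (D.L * D.muBar * D.fareMax ≤ D.cr * M →
        D.IsOptimal (D.pathPolicy (D.outputPath M) x) ∧
        D.IsOptimal
          { dispatch := D.typeRule, rate := (D.pathPolicy (D.outputPath M) x).rate }) :=
  theorem2_general D hD.monotoneTypes hc M
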